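/- A hypergraph $G$ with finite vertex set $V(G)$ and edge set $E(G)$ is $k$-uniform if all its edges have exactly $k$ elements. A splitting of a $k$-uniform hypergraph $G$ is a partition of $V(G)$ into two classes $A$ and $B$ (possibly empty) such that every $k$-element subset of $A$ is an edge of $G$ and no $k$-element subset of $B$ is an edge of $G$; $G$ is split if it has a splitting. Put $N=|V(G)|+|E(G)|$. For every fixed $k$ there is an algorithm that decides whether a given $k$-uniform hypergraph $G$ is split and, if it is, outputs a splitting of $G$. Its running time is $O(N\log N)$, with a constant that depends only on $k$. Here an algorithm is a program for a random access machine with unit-cost operations on words of $O(\log N)$ bits (reading and writing of registers and of arrays at computed positions, addition, truncated subtraction, multiplication, conditional branching), with memory initially zero apart from the input. The input is $|V(G)|$, $|E(G)|$ and the list of the edges, each given by its $k$ vertices; vertices are numbered $0,\dots,|V(G)|-1$, and all orders are arbitrary. The output is the answer together with the class of each vertex if the answer is yes. The time bound is uniform over all inputs with $N\ge 2$. -/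

import Mathlib

/-! ## Split hypergraphs -/

namespace Hypergraph

variable {α : Type*}

/-- All edges of `G` have exactly `k` elements. -/
def IsUniform (G : Hypergraph α) (k : ℕ) : Prop :=
  ∀ e ∈ G.edgeSet, e.encard = k

/-- `(A, B)` is a splitting of `G`: it is a partition of the vertex set into two (possibly empty)
classes such that every `k`-tuple in `A` is an edge and no `k`-tuple in `B` is an edge. -/
structure IsSplitting (G : Hypergraph α) (k : ℕ) (A B : Set α) : Prop where
  union_eq : A ∪ B = G.vertexSet
  disjoint : Disjoint A B
  mem_edgeSet : ∀ e : Set α, e ⊆ A → e.encard = k → e ∈ G.edgeSet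
  notMem_edgeSet : ∀ e : Set α, e ⊆ B → e.encard = k → e ∉ G.edgeSet

/-- `G`, regarded as a `k`-uniform hypergraph, is split. -/
def IsSplit (G : Hypergraph α) (k : ℕ) : Prop :=
  ∃ A B : Set α, G.IsSplitting k A B

/-- The size `N = |V(G)| + |E(G)|` of a finite hypergraph. -/
noncomputable def size (G : Hypergraph α) : ℕ :=
  G.vertexSet.ncard + G.edgeSet.ncard

end Hypergraph

/-! ## Random access machines

A random access machine has registers and arrays, which hold natural numbers. Its programs are
structured (`skip`, assignment, sequencing, conditional, loop), and a program mentions only finitely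
many registers and arrays. Every elementary operation (reading a constant or a register, reading or
writing an array at a computed position, one addition, truncated subtraction or multiplication,
one branch) takes one unit of time. All numbers that arise have to be smaller than a given bound `M`
(the word length of the machine is `log₂ M`); an operation that would leave this range is not
possible, and so a program which attempts it has no execution. -/

namespace RandomAccess

/-- The memory of the machine: the registers and the arrays. -/
structure Memory where
  /-- the content of a register -/
  reg : ℕ → ℕ
  /-- `arr a i` is the content of the array `a` at position `i` -/
  arr : ℕ → ℕ → ℕ

/-- Expressions that a program can evaluate. -/
inductive Expr where
  | const (c : ℕ)
  | reg (r : ℕ)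
  | get (a : ℕ) (i : Expr)
  | add (x y : Expr)
  | sub (x y : Expr)
  | mul (x y : Expr)

/-- The value of an expression; subtraction is truncated at zero. -/
def Expr.val (s : Memory) : Expr → ℕ
  | const c => c
  | reg r => s.reg r
  | get a i => s.arr a (i.val s)
  | add x y => x.val s + y.val s
  | sub x y => x.val s - y.val s
  | mul x y => x.val s * y.val s

/-- The time for the evaluation of an expression: the number of its elementary operations. -/
def Expr.cost : Expr → ℕ
  | const _ => 1
  | reg _ => 1
  | get _ i => i.cost + 1
  | add x y => x.cost + y.cost + 1
  | sub x y => x.cost + y.cost + 1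
  | mul x y => x.cost + y.cost + 1

/-- All numbers that arise in the evaluation of an expression, array positions included, are
smaller than `M`. -/
def Expr.Fits (M : ℕ) (s : Memory) : Expr → Prop
  | const c => c < M
  | reg r => s.reg r < M
  | get a i => i.Fits M s ∧ s.arr a (i.val s) < M
  | add x y => x.Fits M s ∧ y.Fits M s ∧ x.val s + y.val s < M
  | sub x y => x.Fits M s ∧ y.Fits M s
  | mul x y => x.Fits M s ∧ y.Fits M s ∧ x.val s * y.val s < M

/-- Programs. -/
inductive Program where
  | skip
  /-- `r := x` -/
  | set (r : ℕ) (x : Expr)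
  /-- `a[i] := x` -/
  | put (a : ℕ) (i x : Expr)
  | seq (P Q : Program)
  /-- if `x` is not zero then `P` else `Q` -/
  | cond (x : Expr) (P Q : Program)
  /-- while `x` is not zero do `P` -/
  | loop (x : Expr) (P : Program)

/-- Write the value `v` into the register `r`. -/
def Memory.setReg (s : Memory) (r v : ℕ) : Memory where
  reg := Function.update s.reg r v
  arr := s.arr

/-- Write the value `v` into the array `a` at position `i`. -/
def Memory.setArr (s : Memory) (a i v : ℕ) : Memory where
  reg := s.reg
  arr := Function.update s.arr a (Function.update (s.arr a) i v)

/-- `Exec M P s t s'`: on a machine whose numbers are smaller than `M`, the program `P` started in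
memory `s` halts after time `t` in memory `s'`. -/
inductive Exec (M : ℕ) : Program → Memory → ℕ → Memory → Prop where
  | skip (s : Memory) : Exec M .skip s 1 s
  | set (r : ℕ) (x : Expr) (s : Memory) (hx : x.Fits M s) :
      Exec M (.set r x) s (x.cost + 1) (s.setReg r (x.val s))
  | put (a : ℕ) (i x : Expr) (s : Memory) (hi : i.Fits M s) (hx : x.Fits M s) :
      Exec M (.put a i x) s (i.cost + x.cost + 1) (s.setArr a (i.val s) (x.val s))
  | seq {P Q : Program} {s s' s'' : Memory} {t t' : ℕ}
      (hP : Exec M P s t s') (hQ : Exec M Q s' t' s'') :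
      Exec M (.seq P Q) s (t + t') s''
  | cond_true {x : Expr} {P Q : Program} {s s' : Memory} {t : ℕ}
      (hx : x.Fits M s) (h : x.val s ≠ 0) (hP : Exec M P s t s') :
      Exec M (.cond x P Q) s (x.cost + 1 + t) s'
  | cond_false {x : Expr} {P Q : Program} {s s' : Memory} {t : ℕ}
      (hx : x.Fits M s) (h : x.val s = 0) (hQ : Exec M Q s t s') :
      Exec M (.cond x P Q) s (x.cost + 1 + t) s'
  | loop_true {x : Expr} {P : Program} {s s' s'' : Memory} {t t' : ℕ}
      (hx : x.Fits M s) (h : x.val s ≠ 0) (hP : Exec M P s t s')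
      (hL : Exec M (.loop x P) s' t' s'') :
      Exec M (.loop x P) s (x.cost + 1 + t + t') s''
  | loop_false {x : Expr} {P : Program} {s : Memory}
      (hx : x.Fits M s) (h : x.val s = 0) :
      Exec M (.loop x P) s (x.cost + 1) s

end RandomAccess

/-! ## Input and output -/

namespace Hypergraph

variable {α : Type*}

/-- A listing of a finite `k`-uniform hypergraph `G`: the vertices are numbered `0, …, n - 1` in any
order, and the edges are listed without repetition, in any order, each as the list of the numbers
of its `k` vertices, in any order. -/
structure Listing (G : Hypergraph α) (k : ℕ) where
  /-- the number of vertices -/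
  n : ℕ
  /-- the number of edges -/
  m : ℕ
  /-- the vertex with a given number -/
  vertex : Fin n → α
  vertex_injective : Function.Injective vertex
  range_vertex : Set.range vertex = G.vertexSet
  /-- `edge j i` is the number of the `i`-th vertex of the `j`-th edge -/
  edge : Fin m → Fin k → Fin n
  edge_injective : ∀ j, Function.Injective (edge j)
  edgeSet_injective : Function.Injective fun j => Set.range (vertex ∘ edge j)
  range_edgeSet : (Set.range fun j => Set.range (vertex ∘ edge j)) = G.edgeSet

namespace Listing

variable {G : Hypergraph α} {k : ℕ}

/-- The initial memory: register `0` holds the number `n` of vertices, register `1` the number `m`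
of edges, array `0` holds at position `k * j + i` (for `j < m`, `i < k`) the number of the `i`-th
vertex of the `j`-th edge, and everything else is zero. -/
def input (L : G.Listing k) : RandomAccess.Memory where
  reg := fun r => if r = 0 then L.n else if r = 1 then L.m else 0
  arr := fun a x =>
    if h : a = 0 ∧ x < L.m * k then
      (L.edge (Fin.divNat ⟨x, h.2⟩) (Fin.modNat ⟨x, h.2⟩) : ℕ)
    else 0

/-- The set of the vertices whose entry in the output array (array `1`) is `b`. -/
def outputClass (L : G.Listing k) (s : RandomAccess.Memory) (b : ℕ) : Set α :=
  {v | ∃ i : Fin L.n, L.vertex i = v ∧ s.arr 1 i = b}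

end Listing

end Hypergraph

/-! ## A program logic for random access machines -/

namespace RandomAccess

/-! Two splittings of the same vertex set are close to each other: `k` vertices that one of them
puts into `A` and the other into `B` would form a set that is an edge and is not an edge. So there
are fewer than `k` disagreements in each direction, and at most `2 * k` in all
(`card_diff_le_of_valid`). Moreover, a splitting of the whole hypergraph restricts to a splitting of
every block of vertices.

This suggests divide and conquer. The blocks consist of `2 ^ t` consecutive vertices, and on each of
them a colouring is kept that differs from every global solution in at most `2 * k` vertices
(`AtLevel`). On the union of two neighbouring blocks the distance is at most `4 * k`, and a bounded
search tree of that depth repairs the colouring: a `k`-element set that violates the colouring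
contains a vertex whose colour has to change (`Violates.exists_mem_diff`), and each of its `k`
vertices is tried in turn (`ends_searchProg`). If a solution exists, the repaired colouring is valid
on the larger block, hence again within `2 * k` of every solution. If there is none, the invariant
is vacuous, and a test of the last colouring gives the answer.

A violation has to be found in linear time. An edge of colour `0` inside a block is seen by a scan.
A missing `k`-set of colour `1` is found greedily, without looking at all `k`-sets: the next vertex
is always one that lies in the fewest edges that are inside the class and contain the vertices
chosen so far. If all `k`-sets through this vertex and the earlier ones are edges, then its degree
is the largest possible; being also minimal, it is the degree of every other candidate, so no set
through the earlier vertices is missing (`mem_of_minimal_degree`, `Chain.succ`). After `k` rounds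
only the chosen set itself has to be tested.

All blocks of one level are treated in parallel, with arrays indexed by vertices, edges or block
numbers. So a level is a number of passes over vertices and edges that depends on `k` alone, and it
takes time `O(N)`; there are `O(log N)` levels. The program logic does the accounting: `Ends B W P s
Q` bounds the time by a constant of `P` times `W`, with `W = B` for a bounded number of passes and
`W = B * (n.size + 1)` for the whole program, where finally `B = N + 2`. -/

/-- All numbers in the memory are smaller than `B`. -/
def Memory.Bdd (B : ℕ) (s : Memory) : Prop :=
  (∀ r, s.reg r < B) ∧ ∀ a i, s.arr a i < B

@[simp] theorem Memory.setReg_reg (s : Memory) (r v : ℕ) :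
    (s.setReg r v).reg = Function.update s.reg r v := rfl

@[simp] theorem Memory.setReg_arr (s : Memory) (r v : ℕ) : (s.setReg r v).arr = s.arr := rfl

@[simp] theorem Memory.setArr_reg (s : Memory) (a i v : ℕ) : (s.setArr a i v).reg = s.reg := rfl

@[simp] theorem Memory.setArr_arr (s : Memory) (a i v : ℕ) :
    (s.setArr a i v).arr = Function.update s.arr a (Function.update (s.arr a) i v) := rfl

theorem Memory.Bdd.setReg {B : ℕ} {s : Memory} (h : s.Bdd B) {r v : ℕ} (hv : v < B) :
    (s.setReg r v).Bdd B := by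
  refine ⟨fun r' => ?_, h.2⟩
  rcases eq_or_ne r' r with rfl | hr
  · simpa using hv
  · simpa [hr] using h.1 r'

theorem Memory.Bdd.setArr {B : ℕ} {s : Memory} (h : s.Bdd B) {a i v : ℕ} (hv : v < B) :
    (s.setArr a i v).Bdd B := by
  refine ⟨h.1, fun a' i' => ?_⟩
  rcases eq_or_ne a' a with rfl | ha
  · rcases eq_or_ne i' i with rfl | hi
    · simpa using hv
    · simpa [hi] using h.2 a' i'
  · simpa [ha] using h.2 a' i'

/-! ### Sizes of values, and Boolean expressions. -/

namespace Expr

/-- In a memory bounded by `B ≥ 2`, all numbers arising in the evaluation of an expression `x` are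
smaller than `B ^ x.deg`. -/
def deg : Expr → ℕ
  | const c => c
  | reg _ => 1
  | get _ i => i.deg + 1
  | add x y => x.deg + y.deg + 1
  | sub x y => x.deg + y.deg
  | mul x y => x.deg + y.deg

theorem val_lt {B : ℕ} (hB : 2 ≤ B) {s : Memory} (hs : s.Bdd B) (x : Expr) :
    x.val s < B ^ x.deg := by
  induction x with
  | const c => exact Nat.lt_of_lt_of_le Nat.lt_two_pow_self (Nat.pow_le_pow_left hB c)
  | reg r => simpa [deg, val] using hs.1 r
  | get a i ih =>
    refine lt_of_lt_of_le (hs.2 a (i.val s)) ?_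
    exact Nat.le_self_pow (by simp [deg]) B
  | add x y hx hy =>
    simp only [val, deg]
    have h1 : B ^ x.deg ≤ B ^ (x.deg + y.deg) := Nat.pow_le_pow_right (by omega) (by omega)
    have h2 : B ^ y.deg ≤ B ^ (x.deg + y.deg) := Nat.pow_le_pow_right (by omega) (by omega)
    -- Both summands are below `B ^ (x.deg + y.deg)`; the additional factor `B ≥ 2` pays for the
    -- sum.
    rw [pow_succ]
    nlinarith
  | sub x y hx hy =>
    simp only [val, deg]
    have h1 : B ^ x.deg ≤ B ^ (x.deg + y.deg) := Nat.pow_le_pow_right (by omega) (by omega)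
    omega
  | mul x y hx hy =>
    simp only [val, deg, pow_add]
    exact Nat.mul_lt_mul'' hx hy

/-- The degree never increases on passing to a subexpression, so one word bound covers all
intermediate values. This is why a difference is charged for its subtrahend too, although its value
is at most the minuend. -/
theorem fits {B c : ℕ} (hB : 2 ≤ B) {s : Memory} (hs : s.Bdd B) (x : Expr) (hc : x.deg ≤ c) :
    x.Fits (B ^ c) s := by
  have key : ∀ y : Expr, y.deg ≤ c → y.val s < B ^ c := fun y hy =>
    lt_of_lt_of_le (val_lt hB hs y) (Nat.pow_le_pow_right (by omega) hy)
  induction x with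
  | const a => exact key (const a) hc
  | reg r => exact key (reg r) hc
  | get a i ih => exact ⟨ih (by simp only [deg] at hc; omega), key (get a i) hc⟩
  | add x y hx hy =>
    exact ⟨hx (by simp only [deg] at hc; omega), hy (by simp only [deg] at hc; omega),
      key (add x y) hc⟩
  | sub x y hx hy =>
    exact ⟨hx (by simp only [deg] at hc; omega), hy (by simp only [deg] at hc; omega)⟩
  | mul x y hx hy =>
    exact ⟨hx (by simp only [deg] at hc; omega), hy (by simp only [deg] at hc; omega),
      key (mul x y) hc⟩

/-- The expression `x` has the value `1` if `p` holds and `0` otherwise. -/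
def Decides (s : Memory) (x : Expr) (p : Prop) : Prop :=
  (p → x.val s = 1) ∧ (¬ p → x.val s = 0)

theorem Decides.ne_zero {s : Memory} {x : Expr} {p : Prop} (h : x.Decides s p) :
    x.val s ≠ 0 ↔ p := by
  by_cases hp : p
  · simp [h.1 hp, hp]
  · simp [h.2 hp, hp]

theorem Decides.val_eq {s : Memory} {x : Expr} {p : Prop} [Decidable p] (h : x.Decides s p) :
    x.val s = if p then 1 else 0 := by
  split_ifs with hp
  · exact h.1 hp
  · exact h.2 hp

theorem Decides.congr {s : Memory} {x : Expr} {p q : Prop} (h : x.Decides s p) (hpq : p ↔ q) :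
    x.Decides s q :=
  ⟨fun hq => h.1 (hpq.2 hq), fun hq => h.2 fun hp => hq (hpq.1 hp)⟩

/-- Test for equality. -/
def eq (x y : Expr) : Expr := sub (const 1) (add (sub x y) (sub y x))

theorem decides_eq (s : Memory) (x y : Expr) : (eq x y).Decides s (x.val s = y.val s) := by
  constructor <;> intro h <;> simp only [eq, val] <;> omega

/-- Negation. -/
def not (x : Expr) : Expr := sub (const 1) x

theorem Decides.not {s : Memory} {x : Expr} {p : Prop} (h : x.Decides s p) :
    x.not.Decides s (¬ p) := by
  constructor
  · intro hp
    simp [Expr.not, val, h.2 hp]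
  · intro hp
    simp [Expr.not, val, h.1 (not_not.1 hp)]

theorem Decides.mul {s : Memory} {x y : Expr} {p q : Prop} (hx : x.Decides s p)
    (hy : y.Decides s q) : (mul x y).Decides s (p ∧ q) := by
  constructor
  · rintro ⟨hp, hq⟩
    simp [val, hx.1 hp, hy.1 hq]
  · intro h
    by_cases hp : p
    · simp [val, hy.2 fun hq => h ⟨hp, hq⟩]
    · simp [val, hx.2 hp]

/-- Conjunction over the numbers less than `k`. -/
def all : ℕ → (ℕ → Expr) → Expr
  | 0, _ => const 1
  | k + 1, f => mul (all k f) (f k)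

theorem Decides.all {s : Memory} {f : ℕ → Expr} {p : ℕ → Prop} {k : ℕ}
    (h : ∀ i < k, (f i).Decides s (p i)) : (all k f).Decides s (∀ i < k, p i) := by
  induction k with
  | zero => simp [Decides, Expr.all, val]
  | succ k ih =>
    refine ((ih fun i hi => h i (by omega)).mul (h k (by omega))).congr ?_
    constructor
    · rintro ⟨h1, h2⟩ i hi
      rcases Nat.lt_succ_iff_lt_or_eq.1 hi with hi | rfl
      · exact h1 i hi
      · exact h2
    · exact fun h => ⟨fun i hi => h i (by omega), h k (by omega)⟩

/-- Disjunction over the numbers less than `k`. -/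
def any (k : ℕ) (f : ℕ → Expr) : Expr := (all k fun i => (f i).not).not

theorem Decides.any {s : Memory} {f : ℕ → Expr} {p : ℕ → Prop} {k : ℕ}
    (h : ∀ i < k, (f i).Decides s (p i)) : (any k f).Decides s (∃ i < k, p i) :=
  (Decides.all fun i hi => (h i hi).not).not.congr (by push Not; rfl)

end Expr

/-! ### Time, word length and frame of a program, read off its syntax. -/

namespace Program

/-- A bound for the degrees of the expressions of a program. -/
def deg : Program → ℕ
  | skip => 0
  | set _ x => x.deg
  | put _ i x => i.deg + x.deg
  | seq P Q => P.deg + Q.deg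
  | cond x P Q => x.deg + P.deg + Q.deg
  | loop x P => x.deg + P.deg

/-- The time of a program, when each loop is traversed once. -/
def steps : Program → ℕ
  | skip => 1
  | set _ x => x.cost + 1
  | put _ i x => i.cost + x.cost + 1
  | seq P Q => P.steps + Q.steps
  | cond x P Q => x.cost + 1 + (P.steps + Q.steps)
  | loop x P => x.cost + 1 + P.steps

/-- The program contains an assignment to the register `r`. -/
def WritesReg : Program → ℕ → Prop
  | skip, _ => False
  | set r' _, r => r = r'
  | put _ _ _, _ => False
  | seq P Q, r => P.WritesReg r ∨ Q.WritesReg r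
  | cond _ P Q, r => P.WritesReg r ∨ Q.WritesReg r
  | loop _ P, r => P.WritesReg r

/-- The program contains an assignment to the array `a`. -/
def WritesArr : Program → ℕ → Prop
  | skip, _ => False
  | set _ _, _ => False
  | put a' _ _, a => a = a'
  | seq P Q, a => P.WritesArr a ∨ Q.WritesArr a
  | cond _ P Q, a => P.WritesArr a ∨ Q.WritesArr a
  | loop _ P, a => P.WritesArr a

/-- The memories agree outside of the registers and arrays which the program can change. -/
def Frame (P : Program) (s s' : Memory) : Prop :=
  (∀ r, ¬ P.WritesReg r → s'.reg r = s.reg r) ∧ ∀ a, ¬ P.WritesArr a → s'.arr a = s.arr a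

theorem Frame.trans {P Q R : Program} {s s' s'' : Memory} (h : P.Frame s s') (h' : Q.Frame s' s'')
    (hr : ∀ r, ¬ R.WritesReg r → ¬ P.WritesReg r ∧ ¬ Q.WritesReg r)
    (ha : ∀ a, ¬ R.WritesArr a → ¬ P.WritesArr a ∧ ¬ Q.WritesArr a) : R.Frame s s'' :=
  ⟨fun r h1 => (h'.1 r (hr r h1).2).trans (h.1 r (hr r h1).1),
    fun a h1 => (h'.2 a (ha a h1).2).trans (h.2 a (ha a h1).1)⟩

/-- Since the frame is syntactic, every execution provides it. The rules `Ends.imp` and `Ends.seq`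
hand it on, so that a specification need only speak of what changes. -/
theorem frame_of_exec {M : ℕ} {P : Program} {s s' : Memory} {t : ℕ} (h : Exec M P s t s') :
    P.Frame s s' := by
  induction h with
  | skip s => exact ⟨fun _ _ => rfl, fun _ _ => rfl⟩
  | set r x s hx =>
    exact ⟨fun r' h => by simpa using Function.update_of_ne h _ _, fun _ _ => rfl⟩
  | put a i x s hi hx =>
    exact ⟨fun _ _ => rfl, fun a' h => by simpa using Function.update_of_ne h _ _⟩
  | seq _ _ h1 h2 => exact h1.trans h2 (fun _ => not_or.1) (fun _ => not_or.1)
  | cond_true _ _ _ h =>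
    exact ⟨fun r hr => h.1 r (not_or.1 hr).1, fun a ha => h.2 a (not_or.1 ha).1⟩
  | cond_false _ _ _ h =>
    exact ⟨fun r hr => h.1 r (not_or.1 hr).2, fun a ha => h.2 a (not_or.1 ha).2⟩
  | loop_true _ _ _ _ h1 h2 => exact h1.trans h2 (fun _ h => ⟨h, h⟩) (fun _ h => ⟨h, h⟩)
  | loop_false _ _ => exact ⟨fun _ _ => rfl, fun _ _ => rfl⟩

end Program

/-- On every machine with large enough words, the program `P` started in memory `s` halts in time at
most `P.steps * W`, in a memory that is bounded by `B` and satisfies `Q`. -/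
def Ends (B W : ℕ) (P : Program) (s : Memory) (Q : Memory → Prop) : Prop :=
  ∀ c, P.deg ≤ c → ∃ t s', Exec (B ^ c) P s t s' ∧ t ≤ P.steps * W ∧ s'.Bdd B ∧ Q s'

namespace Ends

variable {B W : ℕ} {P P' : Program} {s : Memory} {Q R : Memory → Prop}

theorem mono {W' : ℕ} (h : Ends B W P s Q) (hW : W ≤ W')
    (hQ : ∀ s', s'.Bdd B → P.Frame s s' → Q s' → R s') :
    Ends B W' P s R := by
  intro c hc
  obtain ⟨t, s', h1, h2, h3, h4⟩ := h c hc
  exact ⟨t, s', h1, h2.trans (Nat.mul_le_mul_left _ hW), h3,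
    hQ s' h3 (Program.frame_of_exec h1) h4⟩

theorem imp (h : Ends B W P s Q) (hQ : ∀ s', s'.Bdd B → P.Frame s s' → Q s' → R s') :
    Ends B W P s R := h.mono le_rfl hQ

theorem skip (hW : 1 ≤ W) (hs : s.Bdd B) (hQ : Q s) : Ends B W .skip s Q :=
  fun _ _ => ⟨1, s, .skip s, by simpa [Program.steps] using hW, hs, hQ⟩

theorem set {r : ℕ} {x : Expr} (hB : 2 ≤ B) (hW : 1 ≤ W) (hs : s.Bdd B) (hx : x.val s < B)
    (hQ : Q (s.setReg r (x.val s))) : Ends B W (.set r x) s Q :=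
  fun _ hc => ⟨_, _, .set r x s (x.fits hB hs hc), Nat.le_mul_of_pos_right _ hW, hs.setReg hx, hQ⟩

theorem put {a : ℕ} {i x : Expr} (hB : 2 ≤ B) (hW : 1 ≤ W) (hs : s.Bdd B) (hx : x.val s < B)
    (hQ : Q (s.setArr a (i.val s) (x.val s))) : Ends B W (.put a i x) s Q := by
  intro c hc
  simp only [Program.deg] at hc
  exact ⟨_, _, .put a i x s (i.fits hB hs (by omega)) (x.fits hB hs (by omega)),
    Nat.le_mul_of_pos_right _ hW, hs.setArr hx, hQ⟩

/-- The specification of `P'` is nested in the postcondition of `P`. As `Ends` quantifies over all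
large `c`, both parts can be run with the word length of the composite. -/
theorem seq (h : Ends B W P s fun s' => s'.Bdd B → P.Frame s s' → Ends B W P' s' Q) :
    Ends B W (.seq P P') s Q := by
  intro c hc
  simp only [Program.deg] at hc
  obtain ⟨t, s', h1, h2, h3, h4⟩ := h c (by omega)
  obtain ⟨t', s'', h5, h6, h7, h8⟩ := h4 h3 (Program.frame_of_exec h1) c (by omega)
  refine ⟨_, _, h1.seq h5, ?_, h7, h8⟩
  simp only [Program.steps, add_mul]
  omega

theorem cond {x : Expr} (hB : 2 ≤ B) (hW : 1 ≤ W) (hs : s.Bdd B) (h1 : x.val s ≠ 0 → Ends B W P s Q)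
    (h2 : x.val s = 0 → Ends B W P' s Q) : Ends B W (.cond x P P') s Q := by
  intro c hc
  simp only [Program.deg] at hc
  have hcost : x.cost + 1 ≤ (x.cost + 1) * W := Nat.le_mul_of_pos_right _ hW
  have hx := x.fits hB hs (c := c) (by omega)
  by_cases h : x.val s = 0
  · obtain ⟨t, s', h3, h4, h5, h6⟩ := h2 h c (by omega)
    refine ⟨_, _, .cond_false hx h h3, ?_, h5, h6⟩
    simp only [Program.steps, add_mul] at *
    omega
  · obtain ⟨t, s', h3, h4, h5, h6⟩ := h1 h c (by omega)
    refine ⟨_, _, .cond_true hx h h3, ?_, h5, h6⟩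
    simp only [Program.steps, add_mul] at *
    omega

/-- A loop whose number of traversals is bounded by a measure that decreases. -/
theorem loop {x : Expr} (hB : 2 ≤ B) (hW : 1 ≤ W) {I : ℕ → Memory → Prop} (L : ℕ) (hs : s.Bdd B)
    (hI : I L s)
    (h : ∀ l s', s'.Bdd B → I l s' → x.val s' ≠ 0 →
      ∃ l', l = l' + 1 ∧ Ends B W P s' (I l')) :
    Ends B (W * (L + 1)) (.loop x P) s fun s' => x.val s' = 0 ∧ ∃ l, I l s' := by
  induction L generalizing s with
  | zero =>
    intro c hc
    simp only [Program.deg] at hc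
    have hx := x.fits hB hs (c := c) (by omega)
    by_cases hv : x.val s = 0
    · refine ⟨_, _, .loop_false hx hv, ?_, hs, hv, _, hI⟩
      simp only [Program.steps, add_mul, zero_add, mul_one]
      have : x.cost ≤ x.cost * W := Nat.le_mul_of_pos_right _ hW
      omega
    · obtain ⟨l', h1, -⟩ := h 0 s hs hI hv
      omega
  | succ L ih =>
    intro c hc
    have hc' := hc
    simp only [Program.deg] at hc
    have hx := x.fits hB hs (c := c) (by omega)
    have hcost : x.cost + 1 ≤ (x.cost + 1) * W := Nat.le_mul_of_pos_right _ hW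
    by_cases hv : x.val s = 0
    · refine ⟨_, _, .loop_false hx hv, ?_, hs, hv, _, hI⟩
      simp only [Program.steps]
      nlinarith [Nat.zero_le (P.steps * W), Nat.zero_le (P.steps * W * (L + 1)),
        Nat.zero_le ((x.cost + 1) * W * (L + 1))]
    · obtain ⟨l', h1, h2⟩ := h (L + 1) s hs hI hv
      obtain rfl : L = l' := by omega
      obtain ⟨t, s', h3, h4, h5, h6⟩ := h2 c (by omega)
      obtain ⟨t', s'', h7, h8, h9, h10⟩ := ih h5 h6 c hc'
      refine ⟨_, _, .loop_true hx hv h3 h7, ?_, h9, h10⟩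
      simp only [Program.steps] at h8 ⊢
      nlinarith

end Ends

/-! ### Bounded repetition and passes over an array. -/

namespace Program

/-- Sequential execution of `f 0, …, f (k - 1)`. -/
def seqRange : ℕ → (ℕ → Program) → Program
  | 0, _ => skip
  | k + 1, f => seq (seqRange k f) (f k)

/-- For each value of register `2` from `0` up to (and without) the content of the register `q`,
do `P`. -/
def forLt (q : ℕ) (P : Program) : Program :=
  seq (set 2 (.const 0))
    (loop (.sub (.reg q) (.reg 2)) (seq P (set 2 (.add (.reg 2) (.const 1)))))

/-- Replace the entries of the array `a`, at the positions less than the content of the register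
`q`, by the value of `x`. -/
def mapLt (q a : ℕ) (x : Expr) : Program := forLt q (put a (.reg 2) x)

@[simp] theorem writesReg_skip (r : ℕ) : ¬ skip.WritesReg r := id
@[simp] theorem writesReg_set (r r' : ℕ) (x : Expr) : (set r' x).WritesReg r ↔ r = r' := Iff.rfl
@[simp] theorem writesReg_put (r a : ℕ) (i x : Expr) : ¬ (put a i x).WritesReg r := id
@[simp] theorem writesReg_seq (r : ℕ) (P Q : Program) :
    (seq P Q).WritesReg r ↔ P.WritesReg r ∨ Q.WritesReg r := Iff.rfl
@[simp] theorem writesReg_cond (r : ℕ) (x : Expr) (P Q : Program) :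
    (cond x P Q).WritesReg r ↔ P.WritesReg r ∨ Q.WritesReg r := Iff.rfl
@[simp] theorem writesReg_loop (r : ℕ) (x : Expr) (P : Program) :
    (loop x P).WritesReg r ↔ P.WritesReg r := Iff.rfl
@[simp] theorem writesArr_skip (a : ℕ) : ¬ skip.WritesArr a := id
@[simp] theorem writesArr_set (a r : ℕ) (x : Expr) : ¬ (set r x).WritesArr a := id
@[simp] theorem writesArr_put (a a' : ℕ) (i x : Expr) : (put a' i x).WritesArr a ↔ a = a' := Iff.rfl
@[simp] theorem writesArr_seq (a : ℕ) (P Q : Program) :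
    (seq P Q).WritesArr a ↔ P.WritesArr a ∨ Q.WritesArr a := Iff.rfl
@[simp] theorem writesArr_cond (a : ℕ) (x : Expr) (P Q : Program) :
    (cond x P Q).WritesArr a ↔ P.WritesArr a ∨ Q.WritesArr a := Iff.rfl
@[simp] theorem writesArr_loop (a : ℕ) (x : Expr) (P : Program) :
    (loop x P).WritesArr a ↔ P.WritesArr a := Iff.rfl

@[simp] theorem writesReg_seqRange (r k : ℕ) (f : ℕ → Program) :
    (seqRange k f).WritesReg r ↔ ∃ i < k, (f i).WritesReg r := by
  induction k with
  | zero => simp [seqRange]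
  | succ k ih => simp only [seqRange, writesReg_seq, ih, Nat.exists_lt_succ_right]

@[simp] theorem writesArr_seqRange (a k : ℕ) (f : ℕ → Program) :
    (seqRange k f).WritesArr a ↔ ∃ i < k, (f i).WritesArr a := by
  induction k with
  | zero => simp [seqRange]
  | succ k ih => simp only [seqRange, writesArr_seq, ih, Nat.exists_lt_succ_right]

@[simp] theorem writesReg_forLt (r q : ℕ) (P : Program) :
    (forLt q P).WritesReg r ↔ r = 2 ∨ P.WritesReg r := by
  simp only [forLt, writesReg_seq, writesReg_set, writesReg_loop]
  tauto

@[simp] theorem writesArr_forLt (a q : ℕ) (P : Program) :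
    (forLt q P).WritesArr a ↔ P.WritesArr a := by
  simp [forLt]

@[simp] theorem writesReg_mapLt (r q a : ℕ) (x : Expr) : (mapLt q a x).WritesReg r ↔ r = 2 := by
  simp [mapLt]

@[simp] theorem writesArr_mapLt (a q a' : ℕ) (x : Expr) :
    (mapLt q a' x).WritesArr a ↔ a = a' := by
  simp [mapLt]

end Program

namespace Ends

variable {B W : ℕ} {P : Program} {s : Memory}

theorem seqRange {f : ℕ → Program} {I : ℕ → Memory → Prop} (k : ℕ) (hW : 1 ≤ W) (hs : s.Bdd B)
    (h0 : I 0 s)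
    (h : ∀ i < k, ∀ s', s'.Bdd B → (Program.seqRange i f).Frame s s' → I i s' →
      Ends B W (f i) s' (I (i + 1))) :
    Ends B W (.seqRange k f) s (I k) := by
  induction k with
  | zero => exact skip hW hs h0
  | succ k ih =>
    exact seq ((ih fun i hi => h i (by omega)).imp fun s' _ _ h1 h2 h3 =>
      h k (by omega) s' h2 h3 h1)

/-- The body runs in time independent of `B` (factor `1`), and there are fewer than `B` passes,
whence the factor `B`. The body writes no register, so the counter survives it and an invariant on
the arrays suffices. -/
theorem forLt {q : ℕ} {I : ℕ → (ℕ → ℕ → ℕ) → Prop} (hB : 2 ≤ B) (hW : B ≤ W) (hq : q ≠ 2)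
    (hP : ∀ r, ¬ P.WritesReg r) (hs : s.Bdd B) (h0 : I 0 s.arr)
    (h : ∀ i < s.reg q, ∀ s' : Memory, s'.Bdd B → s'.reg = Function.update s.reg 2 i →
      (∀ a, ¬ P.WritesArr a → s'.arr a = s.arr a) → I i s'.arr →
      Ends B 1 P s' fun s'' => I (i + 1) s''.arr) :
    Ends B W (.forLt q P) s fun s' => I (s.reg q) s'.arr := by
  -- Here `l` is the number of passes still to come. The test and the increment cost `4` each, which
  -- gives `8` per pass; the failing test at the end costs another `4`.
  have key : ∀ l i, l + i = s.reg q → ∀ s' : Memory, s'.Bdd B →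
      s'.reg = Function.update s.reg 2 i → (∀ a, ¬ P.WritesArr a → s'.arr a = s.arr a) →
      I i s'.arr → ∀ c, (Program.forLt q P).deg ≤ c → ∃ t s'', Exec (B ^ c)
        (.loop (.sub (.reg q) (.reg 2)) (.seq P (.set 2 (.add (.reg 2) (.const 1))))) s' t s'' ∧
        t ≤ (P.steps + 8) * l + 4 ∧ s''.Bdd B ∧ I (s.reg q) s''.arr := by
    intro l
    induction l with
    | zero =>
      intro i hi s' hs' hreg harr hI c hc
      refine ⟨_, s', .loop_false (Expr.fits hB hs' _ ?_) ?_, ?_, hs', ?_⟩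
      · simp only [Program.forLt, Program.deg] at hc
        omega
      · simp only [Expr.val, hreg, Function.update_self, Function.update_of_ne hq]
        omega
      · simp [Expr.cost]
      · rwa [← hi, zero_add]
    | succ l ih =>
      intro i hi s' hs' hreg harr hI c hc
      have hc' := hc
      simp only [Program.forLt, Program.deg] at hc
      obtain ⟨t, s1, h1, h2, h3, h4⟩ := h i (by omega) s' hs' hreg harr hI c (by omega)
      have hf := Program.frame_of_exec h1
      have hreg1 : s1.reg = s'.reg := funext fun r => hf.1 r (hP r)
      have hv : (Expr.add (.reg 2) (.const 1)).val s1 = i + 1 := by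
        simp [Expr.val, hreg1, hreg]
      have hlt := hs.1 q
      have h5 : Exec (B ^ c) (.set 2 (.add (.reg 2) (.const 1))) s1 4 (s1.setReg 2 (i + 1)) := by
        have := Exec.set (M := B ^ c) 2 (.add (.reg 2) (.const 1)) s1
          (Expr.fits hB h3 _ (by omega))
        rwa [hv] at this
      obtain ⟨t', s2, h6, h7, h8, h9⟩ := ih (i + 1) (by omega) (s1.setReg 2 (i + 1))
        (h3.setReg (by omega)) (by simp [hreg1, hreg])
        (fun a ha => (hf.2 a ha).trans (harr a ha)) h4 c hc'
      refine ⟨_, s2, .loop_true (Expr.fits hB hs' _ (by omega)) ?_ (.seq h1 h5) h6, ?_, h8, h9⟩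
      · simp only [Expr.val, hreg, Function.update_self, Function.update_of_ne hq]
        omega
      · simp only [Expr.cost]
        nlinarith
  intro c hc
  obtain ⟨t, s', h1, h2, h3, h4⟩ := key (s.reg q) 0 rfl (s.setReg 2 0)
    (hs.setReg (by omega)) rfl (fun _ _ => rfl) h0 c hc
  refine ⟨_, s', .seq (.set 2 (.const 0) s (Expr.fits hB hs _ (by simp [Expr.deg]))) h1, ?_, h3, h4⟩
  have hlt := hs.1 q
  simp only [Program.forLt, Program.steps, Expr.cost]
  nlinarith

/-- Each position is rewritten once, so at pass `i` the entry of `a` at `i` is still the old one and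
`x` may depend on it. Nothing is offered about the other entries of `a`. -/
theorem mapLt {q a : ℕ} {x : Expr} (f : ℕ → ℕ) (hB : 2 ≤ B) (hW : B ≤ W) (hq : q ≠ 2)
    (hs : s.Bdd B)
    (h : ∀ i < s.reg q, ∀ s' : Memory, s'.reg = Function.update s.reg 2 i →
      (∀ a', a' ≠ a → s'.arr a' = s.arr a') → s'.arr a i = s.arr a i → x.val s' = f i ∧ f i < B) :
    Ends B W (.mapLt q a x) s fun s' =>
      (∀ i < s.reg q, s'.arr a i = f i) ∧ ∀ i, s.reg q ≤ i → s'.arr a i = s.arr a i := by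
  refine forLt (I := fun j arr => (∀ i < j, arr a i = f i) ∧ ∀ i, j ≤ i → arr a i = s.arr a i)
    hB hW hq (by simp) hs (by simp) ?_
  intro i hi s' hs' hreg harr hI
  obtain ⟨h1, h2⟩ := h i hi s' hreg (fun a' ha' => harr a' (by simpa using ha')) (hI.2 i le_rfl)
  refine put hB le_rfl hs' (by omega) ?_
  simp only [Expr.val, hreg, Function.update_self, Memory.setArr_arr, h1]
  constructor
  · intro j hj
    rcases Nat.lt_succ_iff_lt_or_eq.1 hj with hj | rfl
    · rw [Function.update_of_ne (by omega), hI.1 j hj]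
    · simp
  · intro j hj
    rw [Function.update_of_ne (by omega), hI.2 j (by omega)]

end Ends

end RandomAccess

/-! ## Colourings of blocks -/

namespace BlockColouring

open Finset

/-- The `j`-th set of a listing. -/
def edgeAt (k : ℕ) (E : ℕ → ℕ → ℕ) (j : ℕ) : Finset ℕ := (range k).image (E j)

/-- `E` lists the members of a family of `k`-element subsets of `{0, …, n - 1}`. -/
structure IsListing (n m k : ℕ) (E : ℕ → ℕ → ℕ) : Prop where
  lt : ∀ j < m, ∀ i < k, E j i < n
  injOn : ∀ j < m, ∀ i < k, ∀ i' < k, E j i = E j i' → i = i'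
  edgeAt_inj : ∀ j < m, ∀ j' < m, edgeAt k E j = edgeAt k E j' → j = j'

/-- The family that is listed by `E`. -/
def family (m k : ℕ) (E : ℕ → ℕ → ℕ) : Set (Finset ℕ) := {e | ∃ j < m, edgeAt k E j = e}

theorem mem_edgeAt {k : ℕ} {E : ℕ → ℕ → ℕ} {j v : ℕ} : v ∈ edgeAt k E j ↔ ∃ i < k, E j i = v := by
  simp [edgeAt]

theorem IsListing.card_edgeAt {n m k : ℕ} {E : ℕ → ℕ → ℕ} (h : IsListing n m k E) {j : ℕ}
    (hj : j < m) : (edgeAt k E j).card = k := by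
  rw [edgeAt, card_image_of_injOn, card_range]
  intro i hi i' hi' he
  exact h.injOn j hj i (by simpa using hi) i' (by simpa using hi') he

/-- On the block `b`, the colouring `χ` (with the colours `1` and `0`) is a splitting: all
`k`-element sets of colour `1` belong to `H`, and no `k`-element set of colour `0` does. -/
def Valid (n k : ℕ) (H : Set (Finset ℕ)) (blk χ : ℕ → ℕ) (b : ℕ) : Prop :=
  ∀ e : Finset ℕ, e.card = k → (∀ v ∈ e, v < n ∧ blk v = b) →
    ((∀ v ∈ e, χ v = 1) → e ∈ H) ∧ ((∀ v ∈ e, χ v = 0) → e ∉ H)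

/-- The `k`-element subset `e` of the block `b` shows that `χ` is not valid. -/
def Violates (n k : ℕ) (H : Set (Finset ℕ)) (blk χ : ℕ → ℕ) (b : ℕ) (e : Finset ℕ) : Prop :=
  e.card = k ∧ (∀ v ∈ e, v < n ∧ blk v = b) ∧
    (((∀ v ∈ e, χ v = 1) ∧ e ∉ H) ∨ ((∀ v ∈ e, χ v = 0) ∧ e ∈ H))

/-- The vertices of the block `b` where the colourings differ. -/
def diff (n : ℕ) (blk χ χ' : ℕ → ℕ) (b : ℕ) : Finset ℕ :=
  (range n).filter fun v => blk v = b ∧ χ v ≠ χ' v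

/-- The vertices of the block `b` of the colour `c`. -/
def colourClass (n : ℕ) (blk χ : ℕ → ℕ) (c b : ℕ) : Finset ℕ :=
  (range n).filter fun v => blk v = b ∧ χ v = c

theorem mem_diff {n : ℕ} {blk χ χ' : ℕ → ℕ} {b v : ℕ} :
    v ∈ diff n blk χ χ' b ↔ v < n ∧ blk v = b ∧ χ v ≠ χ' v := by
  simp [diff]

theorem mem_colourClass {n : ℕ} {blk χ : ℕ → ℕ} {c b v : ℕ} :
    v ∈ colourClass n blk χ c b ↔ v < n ∧ blk v = b ∧ χ v = c := by
  simp [colourClass]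

variable {n k : ℕ} {H : Set (Finset ℕ)} {blk χ χ' : ℕ → ℕ} {b : ℕ}

theorem Valid.congr (h : Valid n k H blk χ b) (hχ : ∀ v < n, blk v = b → χ v = χ' v) :
    Valid n k H blk χ' b := by
  intro e he hb
  obtain ⟨h1, h2⟩ := h e he hb
  exact ⟨fun h => h1 fun v hv => (hχ v (hb v hv).1 (hb v hv).2).trans (h v hv),
    fun h => h2 fun v hv => (hχ v (hb v hv).1 (hb v hv).2).trans (h v hv)⟩

/-- If `k` vertices had colour `1` under one colouring and colour `0` under the other, the first
would make them a member of `H` and the second a non-member. The difference is the union of the two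
directions. -/
theorem card_diff_le_of_valid (hχ : ∀ v < n, χ v ≤ 1) (hχ' : ∀ v < n, χ' v ≤ 1)
    (h : Valid n k H blk χ b) (h' : Valid n k H blk χ' b) :
    (diff n blk χ χ' b).card ≤ 2 * k := by
  have key : ∀ {χ χ' : ℕ → ℕ}, Valid n k H blk χ b → Valid n k H blk χ' b →
      ((range n).filter fun v => blk v = b ∧ χ v = 1 ∧ χ' v = 0).card < k := by
    intro χ χ' h h'
    by_contra! hk
    obtain ⟨e, he, hek⟩ := exists_subset_card_eq hk
    have he' : ∀ v ∈ e, v < n ∧ blk v = b ∧ χ v = 1 ∧ χ' v = 0 := fun v hv => by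
      simpa using he hv
    have hb : ∀ v ∈ e, v < n ∧ blk v = b := fun v hv => ⟨(he' v hv).1, (he' v hv).2.1⟩
    exact (h' e hek hb).2 (fun v hv => (he' v hv).2.2.2)
      ((h e hek hb).1 fun v hv => (he' v hv).2.2.1)
  have hsub : diff n blk χ χ' b ⊆ ((range n).filter fun v => blk v = b ∧ χ v = 1 ∧ χ' v = 0) ∪
      ((range n).filter fun v => blk v = b ∧ χ' v = 1 ∧ χ v = 0) := by
    intro v hv
    rw [mem_diff] at hv
    have h1 := hχ v hv.1
    have h2 := hχ' v hv.1
    simp only [mem_union, mem_filter, mem_range]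
    have := hv.2.2
    rcases Nat.le_one_iff_eq_zero_or_eq_one.1 h1 with h3 | h3 <;>
      rcases Nat.le_one_iff_eq_zero_or_eq_one.1 h2 with h4 | h4 <;> simp_all
  have h1 := key h h'
  have h2 := key h' h
  have h3 := (card_le_card hsub).trans (card_union_le _ _)
  omega

/-- If the colourings agreed on `e`, then `e` would violate `χ'` as well. Hence some vertex of `e`
must be recoloured on the way to `χ'`, which justifies a branching into `k` cases. -/
theorem Violates.exists_mem_diff {e : Finset ℕ} (he : Violates n k H blk χ b e)
    (h : Valid n k H blk χ' b) : ∃ v ∈ e, v ∈ diff n blk χ χ' b := by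
  obtain ⟨h1, h2, h3⟩ := he
  by_contra! h4
  have h5 : ∀ v ∈ e, χ v = χ' v := fun v hv => by
    by_contra h6
    exact h4 v hv (mem_diff.2 ⟨(h2 v hv).1, (h2 v hv).2, h6⟩)
  obtain ⟨h6, h7⟩ := h e h1 h2
  rcases h3 with ⟨h3, h8⟩ | ⟨h3, h8⟩
  · exact h8 (h6 fun v hv => (h5 v hv).symm.trans (h3 v hv))
  · exact h7 (fun v hv => (h5 v hv).symm.trans (h3 v hv)) h8

/-- There are only two colours, so a flip at a point of disagreement creates agreement there. This
decreases the distance by one per level of the search tree. -/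
theorem card_diff_flip {χ₂ : ℕ → ℕ} {v d : ℕ} (hχ : ∀ v < n, χ v ≤ 1) (hχ' : ∀ v < n, χ' v ≤ 1)
    (hv : v ∈ diff n blk χ χ' b) (hd : (diff n blk χ χ' b).card ≤ d + 1) (hv₂ : χ₂ v = 1 - χ v)
    (h₂ : ∀ u < n, blk u = b → u ≠ v → χ₂ u = χ u) : (diff n blk χ₂ χ' b).card ≤ d := by
  have hsub : diff n blk χ₂ χ' b ⊆ (diff n blk χ χ' b).erase v := by
    intro u hu
    rw [mem_diff] at hu
    rw [mem_erase, mem_diff]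
    rw [mem_diff] at hv
    have huv : u ≠ v := by
      rintro rfl
      have h1 := hχ u hu.1
      have h2 := hχ' u hu.1
      omega
    refine ⟨huv, hu.1, hu.2.1, ?_⟩
    rw [← h₂ u hu.1 hu.2.1 huv]
    exact hu.2.2
  have := card_le_card hsub
  rw [card_erase_of_mem hv] at this
  omega

/-- On the block `b`, some valid colouring differs from `χ` in at most `d` vertices. -/
def Near (n k : ℕ) (H : Set (Finset ℕ)) (blk χ : ℕ → ℕ) (d b : ℕ) : Prop :=
  ∃ χ' : ℕ → ℕ, (∀ v < n, χ' v ≤ 1) ∧ Valid n k H blk χ' b ∧ (diff n blk χ χ' b).card ≤ d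

theorem Near.valid (h : Near n k H blk χ 0 b) :
    Valid n k H blk χ b := by
  obtain ⟨χ', -, h1, h2⟩ := h
  refine h1.congr fun v hv hb => ?_
  by_contra hne
  have : v ∈ diff n blk χ χ' b := mem_diff.2 ⟨hv, hb, fun h => hne h.symm⟩
  rw [card_eq_zero.1 (Nat.le_zero.1 h2)] at this
  simp at this

theorem Valid.not_violates {e : Finset ℕ}
    (h : Valid n k H blk χ b) : ¬ Violates n k H blk χ b e := by
  rintro ⟨h1, h2, h3 | h3⟩
  · exact h3.2 ((h e h1 h2).1 h3.1)
  · exact (h e h1 h2).2 h3.1 h3.2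

/-- If, among the members of `F`, which all satisfy `S ⊆ T ⊆ A` and `|T| = k`, as few as possible
contain `v`, and if all the sets in question that contain `v` belong to `F`, then `F` consists of
all the sets in question. -/
theorem mem_of_minimal_degree {A S : Finset ℕ} {F : Finset (Finset ℕ)} {v : ℕ}
    (hF : ∀ T ∈ F, T ⊆ A ∧ T.card = k ∧ S ⊆ T) (hS : S.card < k) (hv : v ∈ A) (hvS : v ∉ S)
    (hmin : ∀ u ∈ A, u ∉ S → (F.filter (v ∈ ·)).card ≤ (F.filter (u ∈ ·)).card)
    (hall : ∀ T ⊆ A, T.card = k → S ⊆ T → v ∈ T → T ∈ F) :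
    ∀ T ⊆ A, T.card = k → S ⊆ T → T ∈ F := by
  intro T hT hTk hST
  obtain ⟨u, huT, huS⟩ : ∃ u ∈ T, u ∉ S := by
    by_contra! h
    have := card_le_card (show T ⊆ S from h)
    omega
  have huA := hT huT
  -- `K w` has the largest size that the degree of `w` in `F` can have; by `hall`, the vertex `v`
  -- attains it.
  set K : ℕ → Finset (Finset ℕ) := fun w => (powersetCard k A).filter fun T => S ⊆ T ∧ w ∈ T with hK
  have hFv : F.filter (v ∈ ·) = K v := by
    ext T
    simp only [hK, mem_filter, mem_powersetCard]
    constructor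
    · rintro ⟨h1, h2⟩
      exact ⟨⟨(hF T h1).1, (hF T h1).2.1⟩, (hF T h1).2.2, h2⟩
    · rintro ⟨⟨h1, h2⟩, h3, h4⟩
      exact ⟨hall T h1 h2 h3 h4, h4⟩
  have hFu : F.filter (u ∈ ·) ⊆ K u := by
    intro T
    simp only [hK, mem_filter, mem_powersetCard]
    rintro ⟨h1, h2⟩
    exact ⟨⟨(hF T h1).1, (hF T h1).2.1⟩, (hF T h1).2.2, h2⟩
  -- The transposition of `u` and `v` preserves `A` and fixes `S` pointwise, so it maps `K u` into
  -- `K v`.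
  have hcard : (K u).card ≤ (K v).card := by
    have hsw : ∀ w ∈ A, Equiv.swap u v w ∈ A := by
      intro w hw
      by_cases h1 : w = u
      · simpa [h1] using hv
      · by_cases h2 : w = v
        · simpa [h2] using huA
        · rwa [Equiv.swap_apply_of_ne_of_ne h1 h2]
    refine card_le_card_of_injOn (fun T => T.map (Equiv.swap u v).toEmbedding) ?_
      (fun _ _ _ _ h => map_injective _ h)
    intro T hT
    simp only [hK, coe_filter, Set.mem_ofPred_eq, mem_powersetCard] at hT ⊢
    obtain ⟨⟨h1, h2⟩, h3, h4⟩ := hT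
    refine ⟨⟨?_, by simpa using h2⟩, ?_, ?_⟩
    · intro w hw
      obtain ⟨x, hx, rfl⟩ := mem_map.1 hw
      exact hsw x (h1 hx)
    · intro w hw
      refine mem_map.2 ⟨w, h3 hw, ?_⟩
      exact Equiv.swap_apply_of_ne_of_ne (fun h => huS (h ▸ hw)) (fun h => hvS (h ▸ hw))
    · exact mem_map.2 ⟨u, h4, by simp⟩
  -- The degree of `u` in `F` is at least that of `v`, which is the size of `K v` and hence at least
  -- the size of `K u`. So `u` has full degree too, and `T`, which contains `u`, is not missing.
  have heq := eq_of_subset_of_card_le hFu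
    (by rw [← hFv] at hcard; exact hcard.trans (hmin u huA huS))
  have : T ∈ F.filter (u ∈ ·) := by
    rw [heq]
    simp only [hK, mem_filter, mem_powersetCard]
    exact ⟨⟨hT, hTk⟩, hST, huT⟩
  exact (mem_filter.1 this).1

/-- The state of the search for a `k`-element set of colour `1` that is not in `H`, after `j`
vertices `x 0, …, x (j - 1)` have been chosen in the class `A`: if there is such a set, then there
is one that contains the chosen vertices. -/
def Chain (k : ℕ) (H : Set (Finset ℕ)) (A : Finset ℕ) (x : ℕ → ℕ) (j : ℕ) : Prop :=
  (range j).image x ⊆ A ∧ ((range j).image x).card = j ∧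
    ((∀ T ⊆ A, T.card = k → (range j).image x ⊆ T → T ∈ H) → ∀ T ⊆ A, T.card = k → T ∈ H)

theorem chain_zero (k : ℕ) (H : Set (Finset ℕ)) (A : Finset ℕ) (x : ℕ → ℕ) : Chain k H A x 0 :=
  ⟨by simp, by simp, fun h T hT hk => h T hT hk (by simp)⟩

theorem Chain.congr {A : Finset ℕ} {x y : ℕ → ℕ} {j : ℕ} (h : Chain k H A x j)
    (hxy : ∀ i < j, x i = y i) : Chain k H A y j := by
  have : (range j).image x = (range j).image y :=
    image_congr fun i hi => hxy i (by simpa using hi)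
  rwa [Chain, this] at h

/-- By minimality of the degree of `x j` in `F`, a missing set through the first `j` chosen vertices
forces one that also contains `x j`. Only the members of `F` have to be counted, never all `k`-sets.
-/
theorem Chain.succ {A : Finset ℕ} {x : ℕ → ℕ} {j : ℕ} {F : Finset (Finset ℕ)}
    (h : Chain k H A x j) (hj : j < k)
    (hF : ∀ T, T ∈ F ↔ T ∈ H ∧ T ⊆ A ∧ T.card = k ∧ (range j).image x ⊆ T)
    (hx : x j ∈ A) (hxj : ∀ i < j, x i ≠ x j)
    (hmin : ∀ u ∈ A, (∀ i < j, x i ≠ u) → (F.filter (x j ∈ ·)).card ≤ (F.filter (u ∈ ·)).card) :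
    Chain k H A x (j + 1) := by
  obtain ⟨h1, h2, h3⟩ := h
  have hnot : ∀ u, u ∉ (range j).image x ↔ ∀ i < j, x i ≠ u := by simp
  have himg : (range (j + 1)).image x = insert (x j) ((range j).image x) := by
    rw [range_add_one, image_insert]
  refine ⟨?_, ?_, fun hall => h3 ?_⟩
  · rw [himg]
    exact insert_subset hx h1
  · rw [himg, card_insert_of_notMem ((hnot _).2 hxj), h2]
  · have := mem_of_minimal_degree (F := F) (k := k) (A := A) (S := (range j).image x) (v := x j)
      (fun T hT => ((hF T).1 hT).2) (by omega) hx ((hnot _).2 hxj)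
      (fun u hu hu' => hmin u hu ((hnot _).1 hu')) ?_
    · intro T hT hTk hST
      exact ((hF T).1 (this T hT hTk hST)).1
    · intro T hT hTk hST hxT
      refine (hF T).2 ⟨hall T hT hTk ?_, hT, hTk, hST⟩
      rw [himg]
      exact insert_subset hxT hST

end BlockColouring

/-! ## The search for violations -/

namespace SplitSearch

open RandomAccess BlockColouring Finset

/-- The array of the `i`-th vertices of the violating sets, at depth `d` of the search. -/
def viol (d i : ℕ) : ℕ := 7 + Nat.pair d (i + 1)

/-- The array that says which blocks have a violating set, at depth `d` of the search. -/
def bad (d : ℕ) : ℕ := 7 + Nat.pair d 0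

@[simp] theorem viol_eq_viol {d i d' i' : ℕ} : viol d i = viol d' i' ↔ d = d' ∧ i = i' := by
  simp [viol]

@[simp] theorem bad_eq_bad {d d' : ℕ} : bad d = bad d' ↔ d = d' := by simp [bad]

@[simp] theorem viol_ne_bad (d i d' : ℕ) : viol d i ≠ bad d' := by simp [viol, bad]

@[simp] theorem bad_ne_viol (d i d' : ℕ) : bad d' ≠ viol d i := by simp [viol, bad]

/-- The arrays below `7` have fixed roles: `0` the edges, `1` the output, `2` the colouring under
trial, `3` the block of each vertex, `4` the table of halves, `5` the degrees, `6` the quality of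
the current choice in each block. Each depth of the search has violation arrays of its own, as these
must survive the recursive calls. -/
theorem viol_ne {d i a : ℕ} (ha : a < 7) : viol d i ≠ a := by simp only [viol]; omega

theorem bad_ne {d a : ℕ} (ha : a < 7) : bad d ≠ a := by simp only [bad]; omega

theorem ne_viol {d i a : ℕ} (ha : a < 7) : a ≠ viol d i := (viol_ne ha).symm

theorem ne_bad {d a : ℕ} (ha : a < 7) : a ≠ bad d := (bad_ne ha).symm

/-- The `i`-th vertex of the edge `e`. -/
def vtx (k : ℕ) (arr : ℕ → ℕ → ℕ) (e i : ℕ) : ℕ := arr 0 (k * e + i)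

/-- The block of the first vertex of the edge `e`. -/
def blkOf (k : ℕ) (arr : ℕ → ℕ → ℕ) (e : ℕ) : ℕ := arr 3 (vtx k arr e 0)

/-- The `i`-th vertex of the current edge. -/
def vtxE (k i : ℕ) : Expr := .get 0 (.add (.mul (.const k) (.reg 2)) (.const i))

/-- The block of the first vertex of the current edge. -/
def blkE (k : ℕ) : Expr := .get 3 (vtxE k 0)

theorem val_vtxE (k i : ℕ) (s : Memory) : (vtxE k i).val s = vtx k s.arr (s.reg 2) i := rfl

theorem val_blkE (k : ℕ) (s : Memory) : (blkE k).val s = blkOf k s.arr (s.reg 2) := rfl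

/-- The edge `e` lies in one block, and all of its vertices have the colour `c`. -/
def Mono (k c : ℕ) (arr : ℕ → ℕ → ℕ) (e : ℕ) : Prop :=
  (∀ i < k, arr 3 (vtx k arr e i) = blkOf k arr e) ∧ ∀ i < k, arr 2 (vtx k arr e i) = c

/-- The test of `Mono` for the current edge. -/
def monoE (k c : ℕ) : Expr :=
  .mul (.all k fun i => .eq (.get 3 (vtxE k i)) (blkE k))
    (.all k fun i => .eq (.get 2 (vtxE k i)) (.const c))

theorem decides_monoE (k c : ℕ) (s : Memory) :
    (monoE k c).Decides s (Mono k c s.arr (s.reg 2)) :=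
  (Expr.Decides.all fun _ _ => Expr.decides_eq s _ _).mul
    (Expr.Decides.all fun _ _ => Expr.decides_eq s _ _)

/-- The edge `e` lies in the colour class `1` of a block and contains the `j` vertices that have
been chosen for that block. -/
def Alive (k d j : ℕ) (arr : ℕ → ℕ → ℕ) (e : ℕ) : Prop :=
  Mono k 1 arr e ∧ ∀ i < j, ∃ i' < k, vtx k arr e i' = arr (viol d i) (blkOf k arr e)

/-- The test of `Alive` for the current edge. -/
def aliveE (k d j : ℕ) : Expr :=
  .mul (monoE k 1) (.all j fun i => .any k fun i' => .eq (vtxE k i') (.get (viol d i) (blkE k)))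

theorem decides_aliveE (k d j : ℕ) (s : Memory) :
    (aliveE k d j).Decides s (Alive k d j s.arr (s.reg 2)) :=
  (decides_monoE k 1 s).mul
    (Expr.Decides.all fun _ _ => Expr.Decides.any fun _ _ => Expr.decides_eq s _ _)

theorem Alive.congr {k d j e : ℕ} {arr arr' : ℕ → ℕ → ℕ} (h0 : arr' 0 = arr 0)
    (h2 : arr' 2 = arr 2) (h3 : arr' 3 = arr 3) (hv : ∀ i < j, arr' (viol d i) = arr (viol d i)) :
    Alive k d j arr' e ↔ Alive k d j arr e := by
  simp only [Alive, Mono, vtx, blkOf, h0, h2, h3]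
  refine and_congr_right fun _ => forall₂_congr fun i hi => ?_
  rw [hv i hi]

/-- The vertex `v` is in the block `b`, of colour `1`, and not among the `j` chosen vertices. -/
def Cand (d j : ℕ) (arr : ℕ → ℕ → ℕ) (b v : ℕ) : Prop :=
  arr 3 v = b ∧ arr 2 v = 1 ∧ ∀ i < j, arr (viol d i) b ≠ v

/-- The test of `Cand` for the current vertex and its block. -/
def candE (d j : ℕ) : Expr :=
  .mul (.eq (.get 2 (.reg 2)) (.const 1))
    (.all j fun i => .not (.eq (.get (viol d i) (.get 3 (.reg 2))) (.reg 2)))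

theorem decides_candE (d j : ℕ) (s : Memory) :
    (candE d j).Decides s (Cand d j s.arr (s.arr 3 (s.reg 2)) (s.reg 2)) := by
  refine ((Expr.decides_eq s _ _).mul
    (Expr.Decides.all fun _ _ => (Expr.decides_eq s _ _).not)).congr ?_
  simp [Cand, Expr.val]

theorem Cand.congr {d j b v : ℕ} {arr arr' : ℕ → ℕ → ℕ} (h2 : arr' 2 = arr 2) (h3 : arr' 3 = arr 3)
    (hv : ∀ i < j, arr' (viol d i) = arr (viol d i)) :
    Cand d j arr' b v ↔ Cand d j arr b v := by
  simp only [Cand, h2, h3]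
  refine and_congr_right fun _ => and_congr_right fun _ => forall₂_congr fun i hi => ?_
  rw [hv i hi]

open Classical in
/-- The number of the edges among the first `l` that are alive and contain `v`. -/
noncomputable def count (k d j : ℕ) (arr : ℕ → ℕ → ℕ) (l v : ℕ) : ℕ :=
  ∑ e ∈ range l, ∑ i ∈ range k, if Alive k d j arr e ∧ vtx k arr e i = v then 1 else 0

/-- The register contents and arrays that are fixed during the search. -/
structure Setting (B n m k : ℕ) (s : Memory) : Prop where
  two_le : 2 ≤ B
  bdd : s.Bdd B
  n_lt : n + m + 2 ≤ B
  reg0 : s.reg 0 = n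
  reg1 : s.reg 1 = m
  pos : 0 < k
  list : IsListing n m k (vtx k s.arr)
  blk_lt : ∀ v < n, s.arr 3 v < n

theorem Setting.congr {B n m k : ℕ} {s s' : Memory} (h : Setting B n m k s) (hb : s'.Bdd B)
    (h0 : s'.reg 0 = s.reg 0) (h1 : s'.reg 1 = s.reg 1) (a0 : s'.arr 0 = s.arr 0)
    (a3 : s'.arr 3 = s.arr 3) : Setting B n m k s' where
  two_le := h.two_le
  bdd := hb
  n_lt := h.n_lt
  reg0 := h0.trans h.reg0
  reg1 := h1.trans h.reg1
  pos := h.pos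
  list := by
    have : vtx k s'.arr = vtx k s.arr := by ext; simp [vtx, a0]
    rw [this]
    exact h.list
  blk_lt := by rw [a3]; exact h.blk_lt

variable {B n m k : ℕ} {s : Memory}

theorem sum_vtx_le_one (h : IsListing n m k (vtx k s.arr)) (p : Prop) [Decidable p] {e v : ℕ}
    (he : e < m) :
    (∑ i ∈ range k, if p ∧ vtx k s.arr e i = v then 1 else 0) ≤ 1 := by
  rw [← card_filter, card_le_one]
  intro i hi i' hi'
  simp only [mem_filter, mem_range] at hi hi'
  exact h.injOn e he i hi.1 i' hi'.1 (hi.2.2.trans hi'.2.2.symm)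

-- The double sum is what the counting loop accumulates. The vertices of an edge are distinct, so
-- every edge contributes at most once; the sum is therefore a degree, and no counter exceeds `m`.
open Classical in
theorem count_eq_card (h : IsListing n m k (vtx k s.arr)) (d j v : ℕ) :
    count k d j s.arr m v =
      ((range m).filter fun e => Alive k d j s.arr e ∧ v ∈ edgeAt k (vtx k s.arr) e).card := by
  rw [count, card_filter]
  refine sum_congr rfl fun e he => ?_
  rw [mem_range] at he
  have h1 := sum_vtx_le_one h (Alive k d j s.arr e) he (v := v)
  split_ifs with hc
  · refine le_antisymm h1 ?_
    obtain ⟨i, hi, hv⟩ := mem_edgeAt.1 hc.2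
    refine le_trans ?_ (single_le_sum (f := fun i => if Alive k d j s.arr e ∧ vtx k s.arr e i = v
      then 1 else 0) (fun _ _ => Nat.zero_le _) (mem_range.2 hi))
    simp [hc.1, hv]
  · refine sum_eq_zero fun i hi => if_neg ?_
    rintro ⟨h2, h3⟩
    exact hc ⟨h2, mem_edgeAt.2 ⟨i, mem_range.1 hi, h3⟩⟩

theorem count_le (h : IsListing n m k (vtx k s.arr)) (d j v : ℕ) :
    count k d j s.arr m v ≤ m := by
  classical
  rw [count_eq_card h]
  exact (card_filter_le _ _).trans (by simp)

/-- For all vertices, count the alive edges that contain the vertex. -/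
def countProg (k d j : ℕ) : Program :=
  .forLt 1 (.seqRange k fun i =>
    .put 5 (vtxE k i) (.add (.get 5 (vtxE k i)) (aliveE k d j)))

theorem ends_countProg (hs : Setting B n m k s) (d j : ℕ) (h0 : ∀ v < n, s.arr 5 v = 0) :
    Ends B B (countProg k d j) s fun s' => ∀ v < n, s'.arr 5 v = count k d j s.arr m v := by
  classical
  rw [← hs.reg1]
  refine Ends.forLt (I := fun l arr => ∀ v < n, arr 5 v = count k d j s.arr l v) hs.two_le le_rfl
    (by omega) (by simp) hs.bdd (by simpa [count] using h0) ?_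
  intro e he s' hs' hreg harr hI
  rw [hs.reg1] at he
  have harr' : ∀ a, a ≠ 5 → s'.arr a = s.arr a := fun a ha => harr a (by simp [ha])
  have hlast : ∀ v, count k d j s.arr (e + 1) v = count k d j s.arr e v +
      ∑ i ∈ range k, if Alive k d j s.arr e ∧ vtx k s.arr e i = v then 1 else 0 := fun v => by
    rw [count, sum_range_succ, ← count]
  refine (Ends.seqRange (I := fun l s'' => ∀ v < n, s''.arr 5 v = count k d j s.arr e v +
    ∑ i ∈ range l, if Alive k d j s.arr e ∧ vtx k s.arr e i = v then 1 else 0) k le_rfl hs'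
    (by simpa using hI) ?_).imp ?_
  · intro i hi s1 hs1 hf hI1
    have harr1 : ∀ a, a ≠ 5 → s1.arr a = s.arr a := fun a ha =>
      (hf.2 a (by simp [ha])).trans (harr' a ha)
    have hreg1 : s1.reg 2 = e := by rw [hf.1 2 (by simp), hreg, Function.update_self]
    have hv : (vtxE k i).val s1 = vtx k s.arr e i := by
      rw [val_vtxE, hreg1, vtx, vtx, harr1 0 (by omega)]
    have ha : (aliveE k d j).val s1 = if Alive k d j s.arr e then 1 else 0 := by
      have h := decides_aliveE k d j s1
      rw [hreg1, Alive.congr (harr1 0 (by omega)) (harr1 2 (by omega)) (harr1 3 (by omega))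
        (fun i _ => harr1 _ (viol_ne (by omega)))] at h
      exact h.val_eq
    have hlt := hs.list.lt e he i hi
    have hval : (Expr.add (.get 5 (vtxE k i)) (aliveE k d j)).val s1 =
        count k d j s.arr e (vtx k s.arr e i) + ∑ i' ∈ range (i + 1),
          if Alive k d j s.arr e ∧ vtx k s.arr e i' = vtx k s.arr e i then 1 else 0 := by
      rw [Expr.val, Expr.val, hv, ha, hI1 _ hlt, sum_range_succ]
      simp [add_assoc]
    refine Ends.put hs.two_le le_rfl hs1 ?_ ?_
    · rw [hval]
      -- The new entry is a partial sum of the final degree, which is at most `m` and so below `B`.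
      have h1 := count_le hs.list d j (vtx k s.arr e i)
      have h2 : count k d j s.arr (e + 1) (vtx k s.arr e i) ≤
          count k d j s.arr m (vtx k s.arr e i) :=
        sum_le_sum_of_subset (range_subset_range.2 he)
      rw [hlast] at h2
      have h3 : (∑ i' ∈ range (i + 1),
          if Alive k d j s.arr e ∧ vtx k s.arr e i' = vtx k s.arr e i then 1 else 0) ≤
          ∑ i' ∈ range k,
          if Alive k d j s.arr e ∧ vtx k s.arr e i' = vtx k s.arr e i then 1 else 0 :=
        sum_le_sum_of_subset (range_subset_range.2 hi)
      have h4 := hs.n_lt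
      omega
    · intro v hvn
      rw [hval, hv, Memory.setArr_arr, Function.update_self]
      by_cases hveq : v = vtx k s.arr e i
      · rw [hveq, Function.update_self]
      · rw [Function.update_of_ne hveq, hI1 v hvn, sum_range_succ, if_neg (fun h => hveq h.2.symm),
          add_zero]
  · intro s'' _ _ h v hv
    rw [h v hv, hlast]

/-- For all blocks, choose the `j`-th vertex. -/
def chooseProg (d j : ℕ) : Program :=
  .forLt 0 (.cond (.mul (candE d j)
      (.sub (.sub (.add (.reg 1) (.const 1)) (.get 5 (.reg 2))) (.get 6 (.get 3 (.reg 2)))))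
    (.seq (.put 6 (.get 3 (.reg 2)) (.sub (.add (.reg 1) (.const 1)) (.get 5 (.reg 2))))
      (.put (viol d j) (.get 3 (.reg 2)) (.reg 2)))
    .skip)

theorem ends_chooseProg (hs : Setting B n m k s) (d j : ℕ) (h6 : ∀ b < n, s.arr 6 b = 0)
    (h5 : ∀ v < n, s.arr 5 v ≤ m) :
    Ends B B (chooseProg d j) s fun s' => ∀ b < n,
      (s'.arr 6 b = 0 ∧ ∀ v < n, ¬ Cand d j s.arr b v) ∨
      (s'.arr 6 b ≠ 0 ∧ s'.arr (viol d j) b < n ∧ Cand d j s.arr b (s'.arr (viol d j) b) ∧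
        ∀ u < n, Cand d j s.arr b u → s.arr 5 (s'.arr (viol d j) b) ≤ s.arr 5 u) := by
  -- For a block with a choice, array `6` holds `m + 1` minus the degree of the chosen vertex. This
  -- is positive since degrees are at most `m`, so that `0` can mean that no candidate has been met.
  -- Smaller degrees give larger entries, and a single truncated difference tests both for a first
  -- candidate and for a better one.
  have key := Ends.forLt (P := .cond (.mul (candE d j)
      (.sub (.sub (.add (.reg 1) (.const 1)) (.get 5 (.reg 2))) (.get 6 (.get 3 (.reg 2)))))
    (.seq (.put 6 (.get 3 (.reg 2)) (.sub (.add (.reg 1) (.const 1)) (.get 5 (.reg 2))))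
      (.put (viol d j) (.get 3 (.reg 2)) (.reg 2)))
    .skip) (q := 0) (W := B) (s := s) (I := fun l arr => ∀ b < n,
      (arr 6 b = 0 ∧ ∀ v < l, ¬ Cand d j s.arr b v) ∨
      (arr 6 b = m + 1 - s.arr 5 (arr (viol d j) b) ∧ arr (viol d j) b < n ∧
        Cand d j s.arr b (arr (viol d j) b) ∧
        ∀ u < l, Cand d j s.arr b u → s.arr 5 (arr (viol d j) b) ≤ s.arr 5 u)) hs.two_le le_rfl
      (by omega) (by simp) hs.bdd (fun b hb => Or.inl ⟨h6 b hb, by simp⟩) ?_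
  · rw [hs.reg0] at key
    refine key.imp fun s' _ _ h b hb => ?_
    rcases h b hb with h | ⟨h1, h2, h3⟩
    · exact Or.inl h
    · refine Or.inr ⟨?_, h2, h3⟩
      have := h5 _ h2
      omega
  intro v hv s' hs' hreg harr hI
  rw [hs.reg0] at hv
  have harr' : ∀ a, a ≠ 6 → a ≠ viol d j → s'.arr a = s.arr a := fun a ha hb =>
    harr a (by simp [ha, hb])
  have a2 := harr' 2 (by omega) (ne_viol (by omega))
  have a3 := harr' 3 (by omega) (ne_viol (by omega))
  have a5 := harr' 5 (by omega) (ne_viol (by omega))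
  have r1 : s'.reg 1 = m := by rw [hreg, Function.update_of_ne (by omega), hs.reg1]
  have r2 : s'.reg 2 = v := by rw [hreg, Function.update_self]
  have hc : (candE d j).Decides s' (Cand d j s.arr (s.arr 3 v) v) := by
    have h := decides_candE d j s'
    rwa [r2, a3, Cand.congr a2 a3 fun i hi => harr' _ (viol_ne (by omega)) (by simp; omega)] at h
  have hblk := hs.blk_lt v hv
  have hother : ∀ b, b ≠ s.arr 3 v → ¬ Cand d j s.arr b v := fun b hb h => hb h.1.symm
  have hBm := hs.n_lt
  have h5v := h5 v hv
  refine Ends.cond hs.two_le le_rfl hs' (fun hne => ?_) (fun heq => ?_)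
  · rw [Expr.val, mul_ne_zero_iff, hc.ne_zero] at hne
    obtain ⟨hcv, hne⟩ := hne
    simp only [Expr.val, r1, r2, a3, a5] at hne
    refine Ends.seq (Ends.put hs.two_le le_rfl hs' ?_ ?_)
    · simp only [Expr.val, r1]
      omega
    intro hb1 hf1
    refine Ends.put hs.two_le le_rfl hb1 ?_ ?_
    · simp only [Expr.val, Memory.setArr_reg, r2]
      omega
    · intro b hb
      simp only [Expr.val, Memory.setArr_reg, Memory.setArr_arr, r1, r2, a3, a5,
        Function.update_of_ne (show (3 : ℕ) ≠ 6 by omega), Function.update_self,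
        Function.update_of_ne (ne_viol (show 6 < 7 by omega)),
        Function.update_of_ne (viol_ne (show 6 < 7 by omega))]
      by_cases hbv : b = s.arr 3 v
      · right
        subst hbv
        simp only [Function.update_self]
        refine ⟨trivial, hv, hcv, fun u hu hcu => ?_⟩
        rcases Nat.lt_succ_iff_lt_or_eq.1 hu with hu | rfl
        · rcases hI _ hb with h | h
          · exact absurd hcu (h.2 u hu)
          · have h1 := h.2.2.2 u hu hcu
            have h2 := h.1
            omega
        · exact le_rfl
      · simp only [Function.update_of_ne hbv]
        rcases hI b hb with h | h
        · refine Or.inl ⟨h.1, fun u hu => ?_⟩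
          rcases Nat.lt_succ_iff_lt_or_eq.1 hu with hu | rfl
          · exact h.2 u hu
          · exact hother b hbv
        · refine Or.inr ⟨h.1, h.2.1, h.2.2.1, fun u hu hcu => ?_⟩
          rcases Nat.lt_succ_iff_lt_or_eq.1 hu with hu | rfl
          · exact h.2.2.2 u hu hcu
          · exact absurd hcu (hother b hbv)
  · refine Ends.skip le_rfl hs' fun b hb => ?_
    by_cases hbv : b = s.arr 3 v ∧ Cand d j s.arr b v
    · obtain ⟨rfl, hcv⟩ := hbv
      rw [Expr.val, hc.1 hcv, one_mul] at heq
      simp only [Expr.val, r1, r2, a3, a5] at heq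
      rcases hI _ hb with h | h
      · have := h.1
        omega
      · refine Or.inr ⟨h.1, h.2.1, h.2.2.1, fun u hu hcu => ?_⟩
        rcases Nat.lt_succ_iff_lt_or_eq.1 hu with hu | rfl
        · exact h.2.2.2 u hu hcu
        · have h1 := h.1
          have h2 := h5 _ h.2.1
          omega
    · have hno : ¬ Cand d j s.arr b v := fun h => hbv ⟨h.1.symm, h⟩
      rcases hI b hb with h | h
      · refine Or.inl ⟨h.1, fun u hu => ?_⟩
        rcases Nat.lt_succ_iff_lt_or_eq.1 hu with hu | rfl
        · exact h.2 u hu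
        · exact hno
      · refine Or.inr ⟨h.1, h.2.1, h.2.2.1, fun u hu hcu => ?_⟩
        rcases Nat.lt_succ_iff_lt_or_eq.1 hu with hu | rfl
        · exact h.2.2.2 u hu hcu
        · exact absurd hcu hno

/-- For all blocks, choose the `j`-th vertex of a `k`-element set of colour `1` that is not an
edge: among the vertices of colour `1` that have not been chosen, one in the least number of alive
edges. -/
def roundProg (k d j : ℕ) : Program :=
  .seq (.mapLt 0 5 (.const 0)) (.seq (.mapLt 0 6 (.const 0))
    (.seq (countProg k d j) (chooseProg d j)))

theorem ends_roundProg (hs : Setting B n m k s) (d j : ℕ) :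
    Ends B B (roundProg k d j) s fun s' => ∀ b < n,
      (s'.arr 6 b = 0 ∧ ∀ v < n, ¬ Cand d j s.arr b v) ∨
      (s'.arr 6 b ≠ 0 ∧ s'.arr (viol d j) b < n ∧ Cand d j s.arr b (s'.arr (viol d j) b) ∧
        ∀ u < n, Cand d j s.arr b u →
          count k d j s.arr m (s'.arr (viol d j) b) ≤ count k d j s.arr m u) := by
  have hB := hs.two_le
  refine Ends.seq ((Ends.mapLt (fun _ => 0) hB le_rfl (by omega) hs.bdd
    fun i _ s' _ _ _ => ⟨rfl, by omega⟩).imp ?_)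
  intro s1 _ _ h1 hb1 hf1
  refine Ends.seq ((Ends.mapLt (fun _ => 0) hB le_rfl (by omega) hb1
    fun i _ s' _ _ _ => ⟨rfl, by omega⟩).imp ?_)
  intro s2 _ _ h2 hb2 hf2
  have reg2 : ∀ r, r ≠ 2 → s2.reg r = s.reg r := fun r hr =>
    (hf2.1 r (by simpa using hr)).trans (hf1.1 r (by simpa using hr))
  have arr2 : ∀ a, a ≠ 5 → a ≠ 6 → s2.arr a = s.arr a := fun a h5 h6 =>
    (hf2.2 a (by simpa using h6)).trans (hf1.2 a (by simpa using h5))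
  have hs2 : Setting B n m k s2 := hs.congr hb2 (reg2 0 (by omega)) (reg2 1 (by omega))
    (arr2 0 (by omega) (by omega)) (arr2 3 (by omega) (by omega))
  rw [hf1.1 0 (by simp), hs.reg0] at h2
  rw [hs.reg0] at h1
  have hcount : ∀ v, count k d j s2.arr m v = count k d j s.arr m v := fun v => by
    unfold count
    refine sum_congr rfl fun e _ => sum_congr rfl fun i _ => ?_
    have := Alive.congr (k := k) (d := d) (j := j) (e := e) (arr2 0 (by omega) (by omega))
      (arr2 2 (by omega) (by omega)) (arr2 3 (by omega) (by omega))
      (fun i _ => arr2 _ (viol_ne (by omega)) (viol_ne (by omega)))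
    have hv : vtx k s2.arr e i = vtx k s.arr e i := by
      rw [vtx, vtx, arr2 0 (by omega) (by omega)]
    rw [hv]
    by_cases h : Alive k d j s.arr e ∧ vtx k s.arr e i = v
    · rw [if_pos h, if_pos ⟨this.2 h.1, h.2⟩]
    · rw [if_neg h, if_neg fun h' => h ⟨this.1 h'.1, h'.2⟩]
  refine Ends.seq ((ends_countProg hs2 d j fun v hv => ?_).imp ?_)
  · rw [hf2.2 5 (by simp)]
    exact h1.1 v hv
  intro s3 _ _ h3 hb3 hf3
  have reg3 : ∀ r, r ≠ 2 → s3.reg r = s2.reg r := fun r hr =>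
    hf3.1 r (by simpa [countProg] using hr)
  have arr3 : ∀ a, a ≠ 5 → s3.arr a = s2.arr a := fun a h5 =>
    hf3.2 a (by simp [countProg, h5])
  have hs3 : Setting B n m k s3 := hs2.congr hb3 (reg3 0 (by omega)) (reg3 1 (by omega))
    (arr3 0 (by omega)) (arr3 3 (by omega))
  have hcand : ∀ b v, Cand d j s3.arr b v ↔ Cand d j s.arr b v := fun b v =>
    Cand.congr ((arr3 2 (by omega)).trans (arr2 2 (by omega) (by omega)))
      ((arr3 3 (by omega)).trans (arr2 3 (by omega) (by omega)))
      (fun i _ => (arr3 _ (viol_ne (by omega))).trans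
        (arr2 _ (viol_ne (by omega)) (viol_ne (by omega))))
  refine (ends_chooseProg hs3 d j (fun b hb => ?_) fun v hv => ?_).imp ?_
  · rw [arr3 6 (by omega)]
    exact h2.1 b hb
  · rw [h3 v hv]
    exact count_le hs2.list d j v
  · intro s4 _ _ h4 b hb
    simp only [hcand] at h4
    rcases h4 b hb with h | ⟨h5, h6, h7, h8⟩
    · exact Or.inl h
    · refine Or.inr ⟨h5, h6, h7, fun u hu hcu => ?_⟩
      have := h8 u hu hcu
      rwa [h3 u hu, h3 _ h6, hcount, hcount] at this

end SplitSearch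

/-! ### Correctness of the greedy search in every block. -/

namespace SplitSearch

open RandomAccess BlockColouring Finset

variable {B n m k : ℕ} {s : Memory}

theorem mono_and_blkOf_iff (hs : Setting B n m k s) {e : ℕ} (he : e < m) (c b : ℕ) :
    Mono k c s.arr e ∧ blkOf k s.arr e = b ↔
      edgeAt k (vtx k s.arr) e ⊆ colourClass n (s.arr 3) (s.arr 2) c b := by
  constructor
  · rintro ⟨⟨h1, h2⟩, rfl⟩ v hv
    obtain ⟨i, hi, rfl⟩ := mem_edgeAt.1 hv
    exact mem_colourClass.2 ⟨hs.list.lt e he i hi, h1 i hi, h2 i hi⟩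
  · intro h
    have h1 : ∀ i < k, s.arr 3 (vtx k s.arr e i) = b ∧ s.arr 2 (vtx k s.arr e i) = c :=
      fun i hi => (mem_colourClass.1 (h (mem_edgeAt.2 ⟨i, hi, rfl⟩))).2
    have h2 := (h1 0 hs.pos).1
    exact ⟨⟨fun i hi => (h1 i hi).1.trans h2.symm, fun i hi => (h1 i hi).2⟩, h2⟩

theorem alive_and_blkOf_iff (hs : Setting B n m k s) {e : ℕ} (he : e < m) (d j b : ℕ) :
    Alive k d j s.arr e ∧ blkOf k s.arr e = b ↔
      edgeAt k (vtx k s.arr) e ⊆ colourClass n (s.arr 3) (s.arr 2) 1 b ∧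
      (range j).image (fun i => s.arr (viol d i) b) ⊆ edgeAt k (vtx k s.arr) e := by
  rw [← mono_and_blkOf_iff hs he, Alive, image_subset_iff]
  constructor
  · rintro ⟨⟨h1, h2⟩, rfl⟩
    exact ⟨⟨h1, rfl⟩, fun i hi => mem_edgeAt.2 (h2 i (mem_range.1 hi))⟩
  · rintro ⟨⟨h1, rfl⟩, h2⟩
    exact ⟨⟨h1, fun i hi => mem_edgeAt.1 (h2 i (mem_range.2 hi))⟩, rfl⟩

/-- The edges that are alive in the block `b`. -/
noncomputable def aliveSets (m k d j : ℕ) (arr : ℕ → ℕ → ℕ) (b : ℕ) : Finset (Finset ℕ) := by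
  classical
  exact ((range m).filter fun e => Alive k d j arr e ∧ blkOf k arr e = b).image
    (edgeAt k (vtx k arr))

theorem mem_aliveSets (hs : Setting B n m k s) (d j b : ℕ) (T : Finset ℕ) :
    T ∈ aliveSets m k d j s.arr b ↔ T ∈ family m k (vtx k s.arr) ∧
      T ⊆ colourClass n (s.arr 3) (s.arr 2) 1 b ∧ T.card = k ∧
      (range j).image (fun i => s.arr (viol d i) b) ⊆ T := by
  simp only [aliveSets, mem_image, mem_filter, mem_range, family, Set.mem_ofPred_eq]
  constructor
  · rintro ⟨e, ⟨he, h⟩, rfl⟩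
    rw [alive_and_blkOf_iff hs he] at h
    exact ⟨⟨e, he, rfl⟩, h.1, hs.list.card_edgeAt he, h.2⟩
  · rintro ⟨⟨e, he, rfl⟩, h1, -, h2⟩
    exact ⟨e, ⟨he, (alive_and_blkOf_iff hs he d j b).2 ⟨h1, h2⟩⟩, rfl⟩

/-- An alive edge through `v` lies in the block of `v`, so one counter per vertex serves all blocks
at once. Different edge numbers give different sets, so numbers may be counted instead of sets. -/
theorem count_eq_card_aliveSets (hs : Setting B n m k s) (d j : ℕ) {v b : ℕ} (hv : s.arr 3 v = b) :
    count k d j s.arr m v = ((aliveSets m k d j s.arr b).filter (v ∈ ·)).card := by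
  classical
  rw [count_eq_card hs.list, aliveSets, filter_image, card_image_of_injOn, filter_filter]
  · congr 1
    refine filter_congr fun e he => ?_
    constructor
    · rintro ⟨h1, h2⟩
      obtain ⟨i, hi, h3⟩ := mem_edgeAt.1 h2
      exact ⟨⟨h1, by rw [← hv, ← h3, h1.1.1 i hi]⟩, h2⟩
    · rintro ⟨⟨h1, -⟩, h2⟩
      exact ⟨h1, h2⟩
  · intro e he e' he' h
    simp only [coe_filter, mem_filter, mem_range, Set.mem_ofPred_eq] at he he'
    exact hs.list.edgeAt_inj e he.1.1 e' he'.1.1 h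

/-- The loop that chooses `k` vertices for each block. -/
theorem ends_rounds (hs : Setting B n m k s) (d : ℕ) :
    Ends B B (.seqRange k (roundProg k d)) s fun s' => ∀ b < n,
      (s'.arr 6 b = 0 → (colourClass n (s.arr 3) (s.arr 2) 1 b).card < k) ∧
      (s'.arr 6 b ≠ 0 → Chain k (family m k (vtx k s.arr))
        (colourClass n (s.arr 3) (s.arr 2) 1 b) (fun i => s'.arr (viol d i) b) k) := by
  set H := family m k (vtx k s.arr) with hH
  set A := colourClass n (s.arr 3) (s.arr 2) 1 with hA
  -- Either the class has run out of candidates, having fewer than `k` vertices, all of them chosen,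
  -- or the choice is a chain. An exhausted class stays exhausted. Array `6` is rebuilt in every
  -- round, so its entries mean something only for `j ≠ 0`; at the end `k > 0` guarantees this.
  have key := Ends.seqRange (B := B) (W := B) (s := s) (f := roundProg k d)
    (I := fun j s' => ∀ b < n,
      (((A b).card < k ∧ ∀ v ∈ A b, ∃ i < j, s'.arr (viol d i) b = v) ∨
        Chain k H (A b) (fun i => s'.arr (viol d i) b) j) ∧
      (j ≠ 0 → (s'.arr 6 b = 0 → (A b).card < k) ∧
        (s'.arr 6 b ≠ 0 → Chain k H (A b) (fun i => s'.arr (viol d i) b) j))) k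
    (by have := hs.two_le; omega) hs.bdd
    (fun b _ => ⟨Or.inr (chain_zero _ _ _ _), fun h => absurd rfl h⟩) ?_
  · exact key.imp fun s' _ _ h b hb => (h b hb).2 hs.pos.ne'
  intro j hj s1 hs1 hf1 hI
  have harr : ∀ a, a ≠ 5 → a ≠ 6 → (∀ i, a ≠ viol d i) → s1.arr a = s.arr a :=
    fun a h5 h6 hv => hf1.2 a (by simp [roundProg, countProg, chooseProg, h5, h6, hv])
  have hreg : ∀ r, r ≠ 2 → s1.reg r = s.reg r := fun r hr =>
    hf1.1 r (by simp [roundProg, countProg, chooseProg, hr])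
  have a0 := harr 0 (by omega) (by omega) fun i => ne_viol (by omega)
  have a2 := harr 2 (by omega) (by omega) fun i => ne_viol (by omega)
  have a3 := harr 3 (by omega) (by omega) fun i => ne_viol (by omega)
  have hset : Setting B n m k s1 := hs.congr hs1 (hreg 0 (by omega)) (hreg 1 (by omega)) a0 a3
  have hH1 : family m k (vtx k s1.arr) = H := by
    have : vtx k s1.arr = vtx k s.arr := by ext; simp [vtx, a0]
    rw [this]
  have hcand : ∀ b v, v < n → (Cand d j s1.arr b v ↔
      v ∈ A b ∧ ∀ i < j, s1.arr (viol d i) b ≠ v) := by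
    intro b v hv
    simp only [Cand, hA, mem_colourClass, a2, a3, hv, true_and, and_assoc]
  refine (ends_roundProg hset d j).imp fun s2 _ hf2 h2 b hb => ?_
  have hviol : ∀ i < j, s2.arr (viol d i) b = s1.arr (viol d i) b := fun i hi => by
    rw [hf2.2 (viol d i) (by
      simp [roundProg, countProg, chooseProg, viol_ne (show 5 < 7 by omega),
        viol_ne (show 6 < 7 by omega)]; omega)]
  obtain ⟨h1, -⟩ := hI b hb
  rcases h2 b hb with ⟨h3, h4⟩ | ⟨h3, h4, h5, h6⟩
  · have hsub : ∀ v ∈ A b, ∃ i < j, s1.arr (viol d i) b = v := by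
      intro v hv
      by_contra! hno
      have hvn := (mem_colourClass.1 hv).1
      exact h4 v hvn ((hcand b v hvn).2 ⟨hv, hno⟩)
    have hcard : (A b).card < k := by
      rcases h1 with h1 | h1
      · exact h1.1
      · have : A b ⊆ (range j).image fun i => s1.arr (viol d i) b := fun v hv => by
          simpa using hsub v hv
        exact (card_le_card this).trans_lt (by rw [h1.2.1]; exact hj)
    refine ⟨Or.inl ⟨hcard, fun v hv => ?_⟩, fun _ => ⟨fun _ => hcard, fun h => absurd h3 h⟩⟩
    obtain ⟨i, hi, h⟩ := hsub v hv
    exact ⟨i, by omega, (hviol i hi).trans h⟩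
  · obtain ⟨hxA, hxne⟩ := (hcand b _ h4).1 h5
    have hch : Chain k H (A b) (fun i => s1.arr (viol d i) b) j := by
      rcases h1 with h1 | h1
      · obtain ⟨i, hi, h⟩ := h1.2 _ hxA
        exact absurd h (hxne i hi)
      · exact h1
    have himg : (range j).image (fun i => s2.arr (viol d i) b) =
        (range j).image fun i => s1.arr (viol d i) b :=
      image_congr fun i hi => hviol i (by simpa using hi)
    have hnew : Chain k H (A b) (fun i => s2.arr (viol d i) b) (j + 1) := by
      refine Chain.succ (F := aliveSets m k d j s1.arr b) (hch.congr fun i hi => (hviol i hi).symm)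
        hj (fun T => ?_) hxA (fun i hi => ?_) fun u hu hu' => ?_
      · rw [mem_aliveSets hset, hH1, himg, a2, a3]
      · rw [hviol i hi]
        exact hxne i hi
      · have hun := (mem_colourClass.1 hu).1
        have hcu := (hcand b u hun).2 ⟨hu, fun i hi => by rw [← hviol i hi]; exact hu' i hi⟩
        have := h6 u hun hcu
        rwa [count_eq_card_aliveSets hset d j h5.1, count_eq_card_aliveSets hset d j hcu.1] at this
    exact ⟨Or.inr hnew, fun _ => ⟨fun h => absurd h h3, fun _ => hnew⟩⟩

/-- For each block, look for a `k`-element set that violates the colouring. -/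
def findProg (k d : ℕ) : Program :=
  .seq (.seqRange k (roundProg k d)) (.seq
    (.mapLt 0 (bad d) (.not (.eq (.get 6 (.reg 2)) (.const 0)))) (.seq
    (.forLt 1 (.cond (aliveE k d k) (.put (bad d) (blkE k) (.const 0)) .skip))
    (.forLt 1 (.cond (monoE k 0) (.seq (.put (bad d) (blkE k) (.const 1))
      (.seqRange k fun i => .put (viol d i) (blkE k) (vtxE k i))) .skip))))

theorem writesReg_findProg (k d r : ℕ) (h : (findProg k d).WritesReg r) : r = 2 := by
  simp [findProg, roundProg, countProg, chooseProg] at h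
  tauto

theorem writesArr_findProg (k d a : ℕ) (h : (findProg k d).WritesArr a) :
    a = 5 ∨ a = 6 ∨ a = bad d ∨ ∃ i < k, a = viol d i := by
  simp [findProg, roundProg, countProg, chooseProg] at h
  grind

theorem ends_clearBad (hs : Setting B n m k s) (d : ℕ) :
    Ends B B (.forLt 1 (.cond (aliveE k d k) (.put (bad d) (blkE k) (.const 0)) .skip)) s
      fun s' => ∀ b, ((∃ e < m, Alive k d k s.arr e ∧ blkOf k s.arr e = b) → s'.arr (bad d) b = 0) ∧
        ((¬ ∃ e < m, Alive k d k s.arr e ∧ blkOf k s.arr e = b) →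
          s'.arr (bad d) b = s.arr (bad d) b) := by
  have hB := hs.two_le
  rw [← hs.reg1]
  refine Ends.forLt (I := fun l arr => ∀ b,
    ((∃ e < l, Alive k d k s.arr e ∧ blkOf k s.arr e = b) → arr (bad d) b = 0) ∧
        ((¬ ∃ e < l, Alive k d k s.arr e ∧ blkOf k s.arr e = b) →
          arr (bad d) b = s.arr (bad d) b)) hB le_rfl
    (by omega) (by simp) hs.bdd (by simp) ?_
  intro e he s' hs' hreg harr hI
  have harr' : ∀ a, a ≠ bad d → s'.arr a = s.arr a := fun a ha => harr a (by simp [ha])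
  have r2 : s'.reg 2 = e := by rw [hreg, Function.update_self]
  have hdec := decides_aliveE k d k s'
  rw [r2, Alive.congr (harr' 0 (ne_bad (by omega))) (harr' 2 (ne_bad (by omega)))
    (harr' 3 (ne_bad (by omega))) (fun i _ => harr' _ (by simp))] at hdec
  have hblk : (blkE k).val s' = blkOf k s.arr e := by
    rw [val_blkE, r2, blkOf, blkOf, vtx, vtx, harr' 0 (ne_bad (by omega)),
      harr' 3 (ne_bad (by omega))]
  have hsucc : ∀ b, (∃ e' < e + 1, Alive k d k s.arr e' ∧ blkOf k s.arr e' = b) ↔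
      (∃ e' < e, Alive k d k s.arr e' ∧ blkOf k s.arr e' = b) ∨
        Alive k d k s.arr e ∧ blkOf k s.arr e = b := fun b => Nat.exists_lt_succ_right
  refine Ends.cond hB le_rfl hs' (fun h => ?_) fun h => ?_
  · rw [hdec.ne_zero] at h
    refine Ends.put hB le_rfl hs' (by simp [Expr.val]; omega) fun b => ?_
    rw [hsucc, hblk, Memory.setArr_arr, Function.update_self]
    by_cases hb : b = blkOf k s.arr e
    · subst hb
      simp [h, Expr.val]
    · rw [Function.update_of_ne hb]
      simpa [Ne.symm hb] using hI b
  · have h' : ¬ Alive k d k s.arr e := fun h1 => hdec.ne_zero.2 h1 h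
    refine Ends.skip le_rfl hs' fun b => ?_
    rw [hsucc]
    simpa [h'] using hI b

/-- A chosen set is a violation unless it turns out to be an edge, in which case the chain shows
that no `k`-set of colour `1` is missing. Edges of colour `0` are violations by themselves and may
overwrite any other. -/
theorem ends_findProg (hs : Setting B n m k s) (d : ℕ) :
    Ends B B (findProg k d) s fun s' => ∀ b < n,
      (s'.arr (bad d) b = 0 ∧ Valid n k (family m k (vtx k s.arr)) (s.arr 3) (s.arr 2) b) ∨
      (s'.arr (bad d) b = 1 ∧ Violates n k (family m k (vtx k s.arr)) (s.arr 3) (s.arr 2) b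
        ((range k).image fun i => s'.arr (viol d i) b)) := by
  have hB := hs.two_le
  set H := family m k (vtx k s.arr) with hH
  set A := colourClass n (s.arr 3) (s.arr 2) 1 with hA
  refine Ends.seq ((ends_rounds hs d).imp fun s1 _ _ h1 hb1 hf1 => ?_)
  have harr1 : ∀ a, a ≠ 5 → a ≠ 6 → (∀ i, a ≠ viol d i) → s1.arr a = s.arr a :=
    fun a h5 h6 hv => hf1.2 a (by simp [roundProg, countProg, chooseProg, h5, h6, hv])
  have hreg1 : ∀ r, r ≠ 2 → s1.reg r = s.reg r := fun r hr =>
    hf1.1 r (by simp [roundProg, countProg, chooseProg, hr])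
  refine Ends.seq ((Ends.mapLt (fun v => if s1.arr 6 v = 0 then 0 else 1) hB le_rfl (by omega) hb1
    fun i _ s' hr ha _ => ?_).imp fun s2 _ _ h2 hb2 hf2 => ?_)
  · have := (Expr.decides_eq s' (.get 6 (.reg 2)) (.const 0)).not
    simp only [Expr.val, hr, Function.update_self, ha 6 (ne_bad (by omega))] at this
    constructor
    · rw [this.val_eq, ite_not]
    · split_ifs <;> omega
  rw [hreg1 0 (by omega), hs.reg0] at h2
  have harr2 : ∀ a, a ≠ 5 → a ≠ 6 → (∀ i, a ≠ viol d i) → a ≠ bad d → s2.arr a = s.arr a :=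
    fun a h5 h6 hv hbad => (hf2.2 a (by simpa using hbad)).trans (harr1 a h5 h6 hv)
  have hreg2 : ∀ r, r ≠ 2 → s2.reg r = s.reg r := fun r hr =>
    (hf2.1 r (by simpa using hr)).trans (hreg1 r hr)
  have a0 := harr2 0 (by omega) (by omega) (fun i => ne_viol (by omega)) (ne_bad (by omega))
  have a2 := harr2 2 (by omega) (by omega) (fun i => ne_viol (by omega)) (ne_bad (by omega))
  have a3 := harr2 3 (by omega) (by omega) (fun i => ne_viol (by omega)) (ne_bad (by omega))
  have hs2 : Setting B n m k s2 := hs.congr hb2 (hreg2 0 (by omega)) (hreg2 1 (by omega)) a0 a3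
  have hv12 : ∀ i, s2.arr (viol d i) = s1.arr (viol d i) := fun i => hf2.2 _ (by simp)
  have hvtx2 : vtx k s2.arr = vtx k s.arr := by ext; simp [vtx, a0]
  refine Ends.seq ((ends_clearBad hs2 d).imp fun s3 _ _ h3 hb3 hf3 => ?_)
  have harr3 : ∀ a, a ≠ bad d → s3.arr a = s2.arr a := fun a ha => hf3.2 a (by simp [ha])
  have hreg3 : ∀ r, r ≠ 2 → s3.reg r = s2.reg r := fun r hr => hf3.1 r (by simp [hr])
  have hs3 : Setting B n m k s3 := hs2.congr hb3 (hreg3 0 (by omega)) (hreg3 1 (by omega))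
    (harr3 0 (ne_bad (by omega))) (harr3 3 (ne_bad (by omega)))
  -- the situation with respect to the colour `1`
  have hone : ∀ b < n, (s3.arr (bad d) b = 0 ∧ ∀ T ⊆ A b, T.card = k → T ∈ H) ∨
      (s3.arr (bad d) b = 1 ∧ Violates n k H (s.arr 3) (s.arr 2) b
        ((range k).image fun i => s3.arr (viol d i) b)) := by
    intro b hb
    have himg : (fun i => s3.arr (viol d i) b) = fun i => s1.arr (viol d i) b := by
      ext i
      rw [harr3 _ (by simp), hv12]
    rw [himg]
    have hbad2 := h2.1 b hb
    obtain ⟨h4, h5⟩ := h1 b hb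
    obtain ⟨h6, h7⟩ := h3 b
    by_cases h8 : s1.arr 6 b = 0
    · left
      rw [if_pos h8] at hbad2
      constructor
      · by_cases h9 : ∃ e < m, Alive k d k s2.arr e ∧ blkOf k s2.arr e = b
        · exact h6 h9
        · rw [h7 h9, hbad2]
      · intro T hT hTk
        exact absurd ((card_le_card hT).trans_lt (h4 h8)) (by omega)
    · rw [if_neg h8] at hbad2
      obtain ⟨hSA, hSk, hall⟩ := h5 h8
      set S := (range k).image fun i => s1.arr (viol d i) b with hS
      -- An edge has `k` elements, so if it contains the `k` chosen vertices it is the chosen set.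
      have hiff : (∃ e < m, Alive k d k s2.arr e ∧ blkOf k s2.arr e = b) ↔ S ∈ H := by
        constructor
        · rintro ⟨e, he, h⟩
          rw [alive_and_blkOf_iff hs2 he] at h
          simp only [hv12, hvtx2] at h
          refine ⟨e, he, (eq_of_subset_of_card_le h.2 ?_).symm⟩
          rw [hs.list.card_edgeAt he]
          exact hSk.ge
        · rintro ⟨e, he, h⟩
          refine ⟨e, he, (alive_and_blkOf_iff hs2 he d k b).2 ?_⟩
          simp only [hv12, hvtx2, a2, a3]
          rw [h]
          exact ⟨hSA, subset_rfl⟩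
      by_cases hSH : S ∈ H
      -- The chain has full length: the only `k`-set containing `S` is `S`, so the premise of `hall`
      -- reduces to `S ∈ H`.
      · refine Or.inl ⟨h6 (hiff.2 hSH), hall fun T hT hTk hST => ?_⟩
        rwa [← eq_of_subset_of_card_le hST (by rw [hTk, hSk])]
      · refine Or.inr ⟨(h7 (mt hiff.1 hSH)).trans hbad2, hSk, fun v hv => ?_,
          Or.inl ⟨fun v hv => ?_, hSH⟩⟩
        · have := mem_colourClass.1 (hSA hv)
          exact ⟨this.1, this.2.1⟩
        · exact (mem_colourClass.1 (hSA hv)).2.2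
  have a0' := (harr3 0 (ne_bad (by omega))).trans a0
  have a2' := (harr3 2 (ne_bad (by omega))).trans a2
  have a3' := (harr3 3 (ne_bad (by omega))).trans a3
  have hvtx3 : vtx k s3.arr = vtx k s.arr := by ext; simp [vtx, a0']
  -- A mark that is still `0` certifies both halves of validity: colour `1` from the rounds, and
  -- colour `0` for the edges scanned so far.
  have key := Ends.forLt (P := .cond (monoE k 0) (.seq (.put (bad d) (blkE k) (.const 1))
      (.seqRange k fun i => .put (viol d i) (blkE k) (vtxE k i))) .skip) (q := 1) (W := B) (s := s3)
    (I := fun l arr => ∀ b < n,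
      (arr (bad d) b = 0 ∧ (∀ T ⊆ A b, T.card = k → T ∈ H) ∧
        ∀ e < l, ¬ edgeAt k (vtx k s.arr) e ⊆ colourClass n (s.arr 3) (s.arr 2) 0 b) ∨
      (arr (bad d) b = 1 ∧ Violates n k H (s.arr 3) (s.arr 2) b
        ((range k).image fun i => arr (viol d i) b))) hB le_rfl
      (by omega) (by simp) hb3 ?_ ?_
  · refine key.imp fun s4 _ _ h4 b hb => ?_
    rw [hs3.reg1] at h4
    rcases h4 b hb with ⟨h5, h6, h7⟩ | h5
    · refine Or.inl ⟨h5, fun e hek hbe => ⟨fun h => h6 e (fun v hv => ?_) hek, ?_⟩⟩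
      · exact mem_colourClass.2 ⟨(hbe v hv).1, (hbe v hv).2, h v hv⟩
      · rintro h ⟨e', he', rfl⟩
        exact h7 e' he' fun v hv => mem_colourClass.2 ⟨(hbe v hv).1, (hbe v hv).2, h v hv⟩
    · exact Or.inr h5
  · intro b hb
    rcases hone b hb with h | h
    · exact Or.inl ⟨h.1, h.2, by simp⟩
    · exact Or.inr h
  · intro e he s4 hb4 hr4 ha4 hI
    rw [hs3.reg1] at he
    have harr4 : ∀ a, a ≠ bad d → (∀ i, a ≠ viol d i) → s4.arr a = s3.arr a := fun a h1 h2 =>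
      ha4 a (by simp [h1, h2])
    have b0 := (harr4 0 (ne_bad (by omega)) fun i => ne_viol (by omega)).trans a0'
    have b2 := (harr4 2 (ne_bad (by omega)) fun i => ne_viol (by omega)).trans a2'
    have b3 := (harr4 3 (ne_bad (by omega)) fun i => ne_viol (by omega)).trans a3'
    have r2 : s4.reg 2 = e := by rw [hr4, Function.update_self]
    have hdec := decides_monoE k 0 s4
    have hmono : Mono k 0 s4.arr (s4.reg 2) ↔ Mono k 0 s.arr e := by
      simp only [Mono, blkOf, vtx, r2, b0, b2, b3]
    rw [hmono] at hdec
    have hlast : ∀ b, b ≠ blkOf k s.arr e → ¬ edgeAt k (vtx k s.arr) e ⊆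
        colourClass n (s.arr 3) (s.arr 2) 0 b := fun b hb h =>
      hb ((mono_and_blkOf_iff hs he 0 b).2 h).2.symm
    refine Ends.cond hB le_rfl hb4 (fun h => ?_) fun h => ?_
    · rw [hdec.ne_zero] at h
      have hsub := (mono_and_blkOf_iff hs he 0 _).1 ⟨h, rfl⟩
      refine Ends.seq (Ends.put hB le_rfl hb4 (by simp [Expr.val]; omega) fun hb5 hf5 => ?_)
      set s5 := s4.setArr (bad d) ((blkE k).val s4) ((Expr.const 1).val s4) with hs5
      have hblk4 : (blkE k).val s4 = blkOf k s.arr e := by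
        rw [val_blkE, r2]
        simp only [blkOf, vtx, b0, b3]
      refine (Ends.seqRange (I := fun j s6 => ∀ b, (b ≠ blkOf k s.arr e →
          ∀ i, s6.arr (viol d i) b = s4.arr (viol d i) b) ∧ (b = blkOf k s.arr e →
          ∀ i < j, s6.arr (viol d i) b = vtx k s.arr e i)) k le_rfl hb5 ?_ ?_).imp
        fun s6 _ hf6 h6 b hb => ?_
      · intro b
        simp [hs5]
      · intro i hi s6 hb6 hf6 hI6
        have harr6 : ∀ a, a ≠ bad d → (∀ i, a ≠ viol d i) → s6.arr a = s4.arr a := fun a h1 h2 => by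
          rw [hf6.2 a (by simp [h2]), hs5, Memory.setArr_arr, Function.update_of_ne h1]
        have c0 := (harr6 0 (ne_bad (by omega)) fun i => ne_viol (by omega)).trans b0
        have c3 := (harr6 3 (ne_bad (by omega)) fun i => ne_viol (by omega)).trans b3
        have r6 : s6.reg 2 = e := by
          rw [hf6.1 2 (by simp), hs5, Memory.setArr_reg, r2]
        have hblk6 : (blkE k).val s6 = blkOf k s.arr e := by
          rw [val_blkE, r6]
          simp only [blkOf, vtx, c0, c3]
        have hv6 : (vtxE k i).val s6 = vtx k s.arr e i := by
          rw [val_vtxE, r6]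
          simp only [vtx, c0]
        refine Ends.put hB le_rfl hb6 ?_ fun b => ?_
        · rw [hv6]
          have := hs.list.lt e he i hi
          have := hs.n_lt
          omega
        · rw [hblk6, hv6, Memory.setArr_arr]
          constructor
          · intro hb i'
            by_cases hi' : i' = i
            · subst hi'
              rw [Function.update_self, Function.update_of_ne hb]
              exact (hI6 b).1 hb i'
            · rw [Function.update_of_ne (by simpa using hi')]
              exact (hI6 b).1 hb i'
          · rintro rfl i' hi'
            by_cases hii : i' = i
            · subst hii
              rw [Function.update_self, Function.update_self]
            · rw [Function.update_of_ne (by simpa using hii)]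
              exact (hI6 _).2 rfl i' (by omega)
      · have hbad6 : s6.arr (bad d) = Function.update (s4.arr (bad d)) (blkOf k s.arr e) 1 := by
          rw [hf6.2 _ (by simp), hs5, Memory.setArr_arr, Function.update_self, hblk4]
          rfl
        rw [hbad6]
        by_cases hbe : b = blkOf k s.arr e
        · right
          have himg : ((range k).image fun i => s6.arr (viol d i) b) = edgeAt k (vtx k s.arr) e :=
            image_congr fun i hi => (h6 b).2 hbe i (by simpa using hi)
          rw [himg]
          subst hbe
          refine ⟨Function.update_self .., hs.list.card_edgeAt he, fun v hv => ?_,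
            Or.inr ⟨fun v hv => ?_, e, he, rfl⟩⟩
          · have := mem_colourClass.1 (hsub hv)
            exact ⟨this.1, this.2.1⟩
          · exact (mem_colourClass.1 (hsub hv)).2.2
        · simp only [Function.update_of_ne hbe, (h6 b).1 hbe]
          rcases hI b hb with ⟨h7, h8, h9⟩ | h7
          · refine Or.inl ⟨h7, h8, fun e' he' => ?_⟩
            rcases Nat.lt_succ_iff_lt_or_eq.1 he' with he' | rfl
            · exact h9 e' he'
            · exact hlast b hbe
          · exact Or.inr h7
    · have h' : ¬ Mono k 0 s.arr e := fun h1 => hdec.ne_zero.2 h1 h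
      refine Ends.skip le_rfl hb4 fun b hb => ?_
      rcases hI b hb with ⟨h7, h8, h9⟩ | h7
      · refine Or.inl ⟨h7, h8, fun e' he' => ?_⟩
        rcases Nat.lt_succ_iff_lt_or_eq.1 he' with he' | rfl
        · exact h9 e' he'
        · exact fun h10 => h' ((mono_and_blkOf_iff hs he 0 b).2 h10).1
      · exact Or.inr h7

end SplitSearch

/-! ## The bounded search tree -/

namespace SplitSearch

open RandomAccess BlockColouring Finset

variable {B n m k : ℕ} {s : Memory}

/-- In all blocks with a violating set, change the colour of the `i`-th vertex of this set. -/
def flipProg (d i : ℕ) : Program :=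
  .mapLt 0 2 (.add
    (.mul (.get 2 (.reg 2)) (.not (.mul (.eq (.get (bad d) (.get 3 (.reg 2))) (.const 1))
      (.eq (.get (viol d i) (.get 3 (.reg 2))) (.reg 2)))))
    (.mul (.not (.get 2 (.reg 2))) (.mul (.eq (.get (bad d) (.get 3 (.reg 2))) (.const 1))
      (.eq (.get (viol d i) (.get 3 (.reg 2))) (.reg 2)))))

/-- With `c` the colour and `p` the truth value of the test, the expression is `c * (1 - p) + (1 -
c) * p`, an exclusive or. The test does not involve the colouring, so a second flip undoes the
first; the clause for `n ≤ v` makes this an equality of whole arrays. -/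
theorem ends_flipProg (hs : Setting B n m k s) (hcol : ∀ v < n, s.arr 2 v ≤ 1) (d i : ℕ) :
    Ends B B (flipProg d i) s fun s' =>
      (∀ v < n, s'.arr 2 v = if s.arr (bad d) (s.arr 3 v) = 1 ∧ s.arr (viol d i) (s.arr 3 v) = v
        then 1 - s.arr 2 v else s.arr 2 v) ∧ ∀ v, n ≤ v → s'.arr 2 v = s.arr 2 v := by
  have key := Ends.mapLt (q := 0) (a := 2) (x := .add
    (.mul (.get 2 (.reg 2)) (.not (.mul (.eq (.get (bad d) (.get 3 (.reg 2))) (.const 1))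
      (.eq (.get (viol d i) (.get 3 (.reg 2))) (.reg 2)))))
    (.mul (.not (.get 2 (.reg 2))) (.mul (.eq (.get (bad d) (.get 3 (.reg 2))) (.const 1))
      (.eq (.get (viol d i) (.get 3 (.reg 2))) (.reg 2)))))
    (fun v => if s.arr (bad d) (s.arr 3 v) = 1 ∧ s.arr (viol d i) (s.arr 3 v) = v
        then 1 - s.arr 2 v else s.arr 2 v) hs.two_le le_rfl (by omega) hs.bdd ?_
  · rw [hs.reg0] at key
    exact key
  intro v hv s' hr ha h2
  rw [hs.reg0] at hv
  have hdec := (Expr.decides_eq s' (.get (bad d) (.get 3 (.reg 2))) (.const 1)).mul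
    (Expr.decides_eq s' (.get (viol d i) (.get 3 (.reg 2))) (.reg 2))
  have hB := hs.two_le
  have hle := hcol v hv
  have r2 : s'.reg 2 = v := by rw [hr, Function.update_self]
  have a3 := ha 3 (by omega)
  have hprop : ((Expr.get (bad d) (.get 3 (.reg 2))).val s' = (Expr.const 1).val s' ∧
      (Expr.get (viol d i) (.get 3 (.reg 2))).val s' = (Expr.reg 2).val s') ↔
      (s.arr (bad d) (s.arr 3 v) = 1 ∧ s.arr (viol d i) (s.arr 3 v) = v) := by
    simp only [Expr.val, r2, a3, ha _ (viol_ne (d := d) (i := i) (show 2 < 7 by omega)),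
      ha _ (bad_ne (d := d) (show 2 < 7 by omega))]
  have hdec2 := hdec.not
  rw [hprop] at hdec hdec2
  have hc : (Expr.get 2 (.reg 2)).val s' = s.arr 2 v := by rw [Expr.val, Expr.val, r2, h2]
  have hcn : (Expr.not (.get 2 (.reg 2))).val s' = 1 - s.arr 2 v := by
    rw [Expr.not, Expr.val, hc, Expr.val]
  constructor
  · rw [Expr.val, Expr.val, Expr.val.eq_6 s' (Expr.not _), hdec.val_eq, hdec2.val_eq, hc, hcn]
    split_ifs <;> simp
  · split_ifs <;> omega

/-- Copy the current colouring to the output in all blocks where it is valid. -/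
def commitProg (d : ℕ) : Program :=
  .mapLt 0 1 (.add (.mul (.get 1 (.reg 2)) (.get (bad d) (.get 3 (.reg 2))))
    (.mul (.get 2 (.reg 2)) (.not (.get (bad d) (.get 3 (.reg 2))))))

theorem ends_commitProg (hs : Setting B n m k s) (d : ℕ)
    (hbad : ∀ b < n, s.arr (bad d) b = 0 ∨ s.arr (bad d) b = 1) :
    Ends B B (commitProg d) s fun s' =>
      ∀ v < n, s'.arr 1 v = if s.arr (bad d) (s.arr 3 v) = 0 then s.arr 2 v else s.arr 1 v := by
  have key := Ends.mapLt (q := 0) (a := 1)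
    (x := .add (.mul (.get 1 (.reg 2)) (.get (bad d) (.get 3 (.reg 2))))
      (.mul (.get 2 (.reg 2)) (.not (.get (bad d) (.get 3 (.reg 2))))))
    (fun v => if s.arr (bad d) (s.arr 3 v) = 0 then s.arr 2 v else s.arr 1 v)
    hs.two_le le_rfl (by omega) hs.bdd ?_
  · rw [hs.reg0] at key
    exact key.imp fun s' _ _ h => h.1
  intro v hv s' hr ha h1
  rw [hs.reg0] at hv
  simp only [Expr.val, Expr.not, hr, Function.update_self, h1, ha 2 (by omega), ha 3 (by omega),
    ha _ (bad_ne (d := d) (show 1 < 7 by omega))]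
  have hb1 := hs.bdd.2 1 v
  have hb2 := hs.bdd.2 2 v
  rcases hbad _ (hs.blk_lt v hv) with h | h
  · simp [h, hb2]
  · simp [h, hb1]

/-- Look for violating sets, and save the colouring where there are none. -/
def findCommit (k d : ℕ) : Program := .seq (findProg k d) (commitProg d)

theorem writesReg_findCommit (k d r : ℕ) (h : (findCommit k d).WritesReg r) : r = 2 := by
  rcases h with h | h
  · exact writesReg_findProg k d r h
  · simpa [commitProg] using h

theorem writesArr_findCommit (k d a : ℕ) (h : (findCommit k d).WritesArr a) :
    a = 1 ∨ a = 5 ∨ a = 6 ∨ a = bad d ∨ ∃ i < k, a = viol d i := by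
  rcases h with h | h
  · exact Or.inr (writesArr_findProg k d a h)
  · exact Or.inl (by simpa [commitProg] using h)

/-- The output of a block is overwritten only by a colouring that is valid there. So a success is
never lost, although different blocks succeed at different nodes of the common search tree. -/
theorem ends_findCommit (hs : Setting B n m k s) (hcol : ∀ v < n, s.arr 2 v ≤ 1)
    (hout : ∀ v < n, s.arr 1 v ≤ 1) (d : ℕ) :
    Ends B B (findCommit k d) s fun s' => (∀ v < n, s'.arr 1 v ≤ 1) ∧
      (∀ b < n, Valid n k (family m k (vtx k s.arr)) (s.arr 3) (s.arr 1) b →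
        Valid n k (family m k (vtx k s.arr)) (s.arr 3) (s'.arr 1) b) ∧
      ∀ b < n, Valid n k (family m k (vtx k s.arr)) (s.arr 3) (s'.arr 1) b ∨
        (s'.arr (bad d) b = 1 ∧ Violates n k (family m k (vtx k s.arr)) (s.arr 3) (s.arr 2) b
          ((range k).image fun i => s'.arr (viol d i) b)) := by
  refine Ends.seq ((ends_findProg hs d).imp fun s1 _ _ h1 hb1 hf1 => ?_)
  have harr : ∀ a < 4, s1.arr a = s.arr a := fun a ha => hf1.2 a fun h => by
    rcases writesArr_findProg k d a h with h | h | h | ⟨i, -, h⟩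
    · omega
    · omega
    · exact bad_ne (by omega) h.symm
    · exact viol_ne (by omega) h.symm
  have hreg : ∀ r, r ≠ 2 → s1.reg r = s.reg r := fun r hr =>
    hf1.1 r fun h => hr (writesReg_findProg k d r h)
  have hs1 : Setting B n m k s1 := hs.congr hb1 (hreg 0 (by omega)) (hreg 1 (by omega))
    (harr 0 (by omega)) (harr 3 (by omega))
  refine (ends_commitProg hs1 d fun b hb => (h1 b hb).imp And.left And.left).imp
    fun s2 _ hf2 h2 => ?_
  rw [harr 1 (by omega), harr 2 (by omega), harr 3 (by omega)] at h2
  have h3 : ∀ b < n, s1.arr (bad d) b = 0 → ∀ v < n, s.arr 3 v = b → s.arr 2 v = s2.arr 1 v := by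
    rintro b - h v hv rfl
    rw [h2 v hv, if_pos h]
  refine ⟨fun v hv => ?_, fun b hb hval => ?_, fun b hb => ?_⟩
  · rw [h2 v hv]
    split_ifs
    exacts [hcol v hv, hout v hv]
  · rcases h1 b hb with h | h
    · exact h.2.congr (h3 b hb h.1)
    · refine hval.congr ?_
      rintro v hv rfl
      rw [h2 v hv, if_neg (by rw [h.1]; omega)]
  · rcases h1 b hb with h | h
    · exact Or.inl (h.2.congr (h3 b hb h.1))
    · right
      have hb' : s2.arr (bad d) = s1.arr (bad d) :=
        hf2.2 _ (by simp [commitProg, bad_ne (show 1 < 7 by omega)])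
      have hv' : ∀ i, s2.arr (viol d i) = s1.arr (viol d i) := fun i =>
        hf2.2 _ (by simp [commitProg, viol_ne (show 1 < 7 by omega)])
      simp only [hb', hv']
      exact h

/-- The search tree of depth `d`, for all blocks in parallel. -/
def searchProg (k : ℕ) : ℕ → Program
  | 0 => findCommit k 0
  | d + 1 => .seq (findCommit k (d + 1)) (.seqRange k fun i =>
      .seq (flipProg (d + 1) i) (.seq (searchProg k d) (flipProg (d + 1) i)))

theorem writesReg_searchProg (k d r : ℕ) (h : (searchProg k d).WritesReg r) : r = 2 := by
  induction d with
  | zero => exact writesReg_findCommit k 0 r h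
  | succ d ih =>
    simp only [searchProg, flipProg, Program.writesReg_seq, Program.writesReg_seqRange,
      Program.writesReg_mapLt] at h
    rcases h with h | ⟨i, hi, h | h | h⟩
    exacts [writesReg_findCommit k _ r h, h, ih h, h]

theorem writesArr_searchProg (k d a : ℕ) (h : (searchProg k d).WritesArr a) :
    a = 1 ∨ a = 2 ∨ a = 5 ∨ a = 6 ∨ ∃ d' ≤ d, a = bad d' ∨ ∃ i < k, a = viol d' i := by
  have hfind : ∀ d, (findCommit k d).WritesArr a →
      a = 1 ∨ a = 2 ∨ a = 5 ∨ a = 6 ∨ ∃ d' ≤ d, a = bad d' ∨ ∃ i < k, a = viol d' i := by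
    intro d h
    rcases writesArr_findCommit k d a h with h | h | h | h
    exacts [.inl h, .inr (.inr (.inl h)), .inr (.inr (.inr (.inl h))),
      .inr (.inr (.inr (.inr ⟨d, le_rfl, h⟩)))]
  induction d with
  | zero => exact hfind 0 h
  | succ d ih =>
    simp only [searchProg, flipProg, Program.writesArr_seq, Program.writesArr_seqRange,
      Program.writesArr_mapLt] at h
    rcases h with h | ⟨i, hi, h | h | h⟩
    · exact hfind _ h
    · exact .inr (.inl h)
    · rcases ih h with h | h | h | h | ⟨d', hd, h⟩
      exacts [.inl h, .inr (.inl h), .inr (.inr (.inl h)), .inr (.inr (.inr (.inl h))),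
        .inr (.inr (.inr (.inr ⟨d', by omega, h⟩)))]
    · exact .inr (.inl h)

theorem arr_eq_of_frame_findCommit {k d : ℕ} {s s' : Memory} (h : (findCommit k d).Frame s s')
    {a : ℕ} (ha : a < 5) (ha1 : a ≠ 1) : s'.arr a = s.arr a :=
  h.2 a fun h => by
    rcases writesArr_findCommit k d a h with h | h | h | h | ⟨i, -, h⟩
    · omega
    · omega
    · omega
    · exact bad_ne (by omega) h.symm
    · exact viol_ne (by omega) h.symm

/-- All blocks walk through the same tree, each flipping the `i`-th vertex of its own violating set.
If a valid colouring is within `d + 1`, one of the `k` flips brings it within `d`. The program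
unfolds the tree, whose size depends on `k` and `d` only, and so the time factor is still `B`. -/
theorem ends_searchProg (d : ℕ) (hs : Setting B n m k s) (hcol : ∀ v < n, s.arr 2 v ≤ 1)
    (hout : ∀ v < n, s.arr 1 v ≤ 1) :
    Ends B B (searchProg k d) s fun s' => s'.arr 2 = s.arr 2 ∧ (∀ v < n, s'.arr 1 v ≤ 1) ∧
      ∀ b < n, Valid n k (family m k (vtx k s.arr)) (s.arr 3) (s.arr 1) b ∨
        Near n k (family m k (vtx k s.arr)) (s.arr 3) (s.arr 2) d b →
        Valid n k (family m k (vtx k s.arr)) (s.arr 3) (s'.arr 1) b := by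
  induction d generalizing s with
  | zero =>
    refine (ends_findCommit hs hcol hout 0).imp fun s1 _ hf1 ⟨h1, h2, h3⟩ => ?_
    refine ⟨arr_eq_of_frame_findCommit hf1 (by omega) (by omega), h1, fun b hb h => ?_⟩
    rcases h with h | h
    · exact h2 b hb h
    · rcases h3 b hb with h4 | h4
      · exact h4
      · exact absurd h4.2 h.valid.not_violates
  | succ d ih =>
    set H := family m k (vtx k s.arr) with hH
    refine Ends.seq ((ends_findCommit hs hcol hout (d + 1)).imp
      fun s1 _ _ ⟨h1, h2, h3⟩ hb1 hf1 => ?_)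
    have hreg1 : ∀ r, r ≠ 2 → s1.reg r = s.reg r := fun r hr =>
      hf1.1 r fun h => hr (writesReg_findCommit k _ r h)
    have harr1 : ∀ a < 5, a ≠ 1 → s1.arr a = s.arr a := fun a ha ha1 =>
      arr_eq_of_frame_findCommit hf1 ha ha1
    -- The last clause records the progress: after `l` branches, a block is settled if one of the
    -- first `l` vertices of its violating set is a point of disagreement with a nearby valid
    -- colouring.
    refine (Ends.seqRange (I := fun l s' => s'.arr 2 = s.arr 2 ∧ (∀ v < n, s'.arr 1 v ≤ 1) ∧
      (∀ b < n, Valid n k H (s.arr 3) (s1.arr 1) b → Valid n k H (s.arr 3) (s'.arr 1) b) ∧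
      ∀ b < n, s1.arr (bad (d + 1)) b = 1 → ∀ χ' : ℕ → ℕ, (∀ v < n, χ' v ≤ 1) →
        Valid n k H (s.arr 3) χ' b → (diff n (s.arr 3) (s.arr 2) χ' b).card ≤ d + 1 →
        (∃ i < l, s1.arr (viol (d + 1) i) b ∈ diff n (s.arr 3) (s.arr 2) χ' b) →
        Valid n k H (s.arr 3) (s'.arr 1) b) k (by have := hs.two_le; omega) hb1
      ⟨harr1 2 (by omega) (by omega), h1, fun _ _ h => h, by simp⟩ ?_).imp ?_
    · intro i hi s2 hb2 hf2 ⟨hI1, hI2, hI3, hI4⟩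
      -- The recursive search writes violation arrays of depth at most `d`, so the sets found at
      -- depth `d + 1` remain intact for the flip back and for the later branches.
      have hw : ∀ {a}, a ≠ 1 → a ≠ 2 → a ≠ 5 → a ≠ 6 → (∀ d' ≤ d, a ≠ bad d' ∧ ∀ i, a ≠ viol d' i) →
          ¬ (searchProg k d).WritesArr a := fun h1 h2 h5 h6 h7 h => by
        rcases writesArr_searchProg k d _ h with h | h | h | h | ⟨d', hd, h | ⟨i, -, h⟩⟩
        exacts [h1 h, h2 h, h5 h, h6 h, (h7 d' hd).1 h, (h7 d' hd).2 i h]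
      have hw0 : ¬ (searchProg k d).WritesArr 0 := hw (by omega) (by omega) (by omega) (by omega)
        fun d' _ => ⟨ne_bad (by omega), fun i => ne_viol (by omega)⟩
      have hw3 : ¬ (searchProg k d).WritesArr 3 := hw (by omega) (by omega) (by omega) (by omega)
        fun d' _ => ⟨ne_bad (by omega), fun i => ne_viol (by omega)⟩
      have hwb : ¬ (searchProg k d).WritesArr (bad (d + 1)) :=
        hw (bad_ne (by omega)) (bad_ne (by omega)) (bad_ne (by omega)) (bad_ne (by omega))
          fun d' hd => ⟨by simp; omega, fun i => by simp⟩
      have hwv : ∀ i, ¬ (searchProg k d).WritesArr (viol (d + 1) i) := fun i =>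
        hw (viol_ne (by omega)) (viol_ne (by omega)) (viol_ne (by omega)) (viol_ne (by omega))
          fun d' hd => ⟨by simp, fun i => by simp; omega⟩
      have harr2 : ∀ a, a ≠ 2 → ¬ (searchProg k d).WritesArr a → s2.arr a = s1.arr a :=
        fun a ha h => hf2.2 a (by simp [flipProg, ha, h])
      have hreg2 : ∀ r, r ≠ 2 → s2.reg r = s.reg r := fun r hr =>
        (hf2.1 r (by
          simp only [flipProg, Program.writesReg_seqRange, Program.writesReg_seq,
            Program.writesReg_mapLt, hr, false_or, or_false]
          exact fun ⟨_, _, h⟩ => hr (writesReg_searchProg k d r h))).trans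
          (hreg1 r hr)
      have a0 := (harr2 0 (by omega) hw0).trans (harr1 0 (by omega) (by omega))
      have a3 := (harr2 3 (by omega) hw3).trans (harr1 3 (by omega) (by omega))
      have ab := harr2 _ (bad_ne (by omega)) hwb
      have av := fun i => harr2 _ (viol_ne (by omega)) (hwv i)
      have hs2 : Setting B n m k s2 :=
        hs.congr hb2 (hreg2 0 (by omega)) (hreg2 1 (by omega)) a0 a3
      refine Ends.seq ((ends_flipProg hs2 (by rw [hI1]; exact hcol) (d + 1) i).imp
        fun s3 _ _ h4 hb3 hf3 => ?_)
      have harr3 : ∀ a, a ≠ 2 → s3.arr a = s2.arr a := fun a ha => hf3.2 a (by simpa [flipProg])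
      have hreg3 : ∀ r, r ≠ 2 → s3.reg r = s2.reg r := fun r hr => hf3.1 r (by simpa [flipProg])
      have hs3 : Setting B n m k s3 := hs2.congr hb3 (hreg3 0 (by omega)) (hreg3 1 (by omega))
        (harr3 0 (by omega)) (harr3 3 (by omega))
      rw [ab, av, a3, hI1] at h4
      have hcol3 : ∀ v < n, s3.arr 2 v ≤ 1 := fun v hv => by
        rw [h4.1 v hv]
        have := hcol v hv
        split_ifs <;> omega
      have hfam : family m k (vtx k s3.arr) = H := by
        have : vtx k s3.arr = vtx k s.arr := by ext; simp [vtx, harr3 0, a0]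
        rw [this]
      refine Ends.seq ((ih hs3 hcol3 (by rw [harr3 1 (by omega)]; exact hI2)).imp
        fun s4 _ _ ⟨h5, h6, h7⟩ hb4 hf4 => ?_)
      rw [hfam, harr3 3 (by omega), a3, harr3 1 (by omega)] at h7
      have hreg4 : ∀ r, r ≠ 2 → s4.reg r = s3.reg r := fun r hr =>
        hf4.1 r fun h => hr (writesReg_searchProg k d r h)
      have hs4 : Setting B n m k s4 := hs3.congr hb4 (hreg4 0 (by omega)) (hreg4 1 (by omega))
        (hf4.2 0 hw0) (hf4.2 3 hw3)
      refine (ends_flipProg hs4 (by rw [h5]; exact hcol3) (d + 1) i).imp fun s5 _ hf5 h8 => ?_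
      have h51 : s5.arr 1 = s4.arr 1 := hf5.2 1 (by simp [flipProg])
      rw [hf4.2 _ hwb, hf4.2 _ (hwv i), hf4.2 3 hw3, harr3 3 (by omega), a3, h5,
        harr3 _ (bad_ne (by omega)), harr3 _ (viol_ne (by omega)), ab, av] at h8
      rw [h51]
      refine ⟨?_, h6, fun b hb h => h7 b hb (Or.inl (hI3 b hb h)), ?_⟩
      -- The two flips cancel, because `1 - (1 - c) = c` for `c ≤ 1`.
      · ext v
        rcases lt_or_ge v n with hv | hv
        · rw [h8.1 v hv, h4.1 v hv]
          have := hcol v hv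
          split_ifs <;> omega
        · rw [h8.2 v hv, h4.2 v hv]
      · rintro b hb hbad χ' hχ' hval hdist ⟨i', hi', hmem⟩
        rcases Nat.lt_succ_iff_lt_or_eq.1 hi' with hi' | rfl
        · exact h7 b hb (Or.inl (hI4 b hb hbad χ' hχ' hval hdist ⟨i', hi', hmem⟩))
        -- The current branch recolours a point of disagreement with `χ'`, so `χ'` is now within
        -- `d`.
        · refine h7 b hb (Or.inr ⟨χ', hχ', hval, ?_⟩)
          have hmem' := mem_diff.1 hmem
          refine card_diff_flip hcol hχ' hmem hdist ?_ fun u hu hub hne => ?_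
          · rw [h4.1 _ hmem'.1, hmem'.2.1, if_pos ⟨hbad, rfl⟩]
          · rw [h4.1 u hu, hub, if_neg fun h => hne h.2.symm]
    · intro s' _ _ ⟨h4, h5, h6, h7⟩
      refine ⟨h4, h5, fun b hb h => ?_⟩
      rcases h3 b hb with h8 | ⟨h8, h9⟩
      · exact h6 b hb h8
      · rcases h with h | ⟨χ', hχ', hval, hdist⟩
        · exact h6 b hb (h2 b hb h)
        · obtain ⟨v, hv, hmem⟩ := h9.exists_mem_diff hval
          obtain ⟨i, hi, rfl⟩ := mem_image.1 hv
          exact h7 b hb h8 χ' hχ' hval hdist ⟨i, mem_range.1 hi, hmem⟩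

end SplitSearch

/-! ## The divide and conquer algorithm -/

namespace SplitSearch

open RandomAccess BlockColouring Finset

variable {B n m k : ℕ} {s : Memory}

/-- Make the output valid in all blocks where it is close to a valid colouring. -/
def processProg (k : ℕ) : Program := .seq (.mapLt 0 2 (.get 1 (.reg 2))) (searchProg k (4 * k))

theorem writesReg_processProg (k r : ℕ) (h : (processProg k).WritesReg r) : r = 2 := by
  rcases h with h | h
  · simpa using h
  · exact writesReg_searchProg k _ r h

theorem arr_eq_of_frame_processProg {k : ℕ} {s s' : Memory} (h : (processProg k).Frame s s')
    {a : ℕ} (ha : a < 5) (ha1 : a ≠ 1) (ha2 : a ≠ 2) : s'.arr a = s.arr a := by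
  refine h.2 a fun h => ?_
  rcases h with h | h
  · exact ha2 (by simpa using h)
  · rcases writesArr_searchProg k _ a h with h | h | h | h | ⟨d', -, h | ⟨i, -, h⟩⟩
    · exact ha1 h
    · exact ha2 h
    · omega
    · omega
    · exact bad_ne (by omega) h.symm
    · exact viol_ne (by omega) h.symm

theorem ends_copy (hs : Setting B n m k s) :
    Ends B B (.mapLt 0 2 (.get 1 (.reg 2))) s fun s' => ∀ v < n, s'.arr 2 v = s.arr 1 v := by
  have key := Ends.mapLt (q := 0) (a := 2) (x := .get 1 (.reg 2)) (s.arr 1) hs.two_le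
    (le_refl B) (by omega) hs.bdd fun v hv s' hr ha h => ?_
  · rw [hs.reg0] at key
    exact key.imp fun s' _ _ h => h.1
  · exact ⟨by rw [Expr.val, Expr.val, hr, Function.update_self, ha 1 (by omega)], hs.bdd.2 1 v⟩

theorem ends_processProg (hs : Setting B n m k s) (hout : ∀ v < n, s.arr 1 v ≤ 1) :
    Ends B B (processProg k) s fun s' => (∀ v < n, s'.arr 1 v ≤ 1) ∧
      ∀ b < n, Near n k (family m k (vtx k s.arr)) (s.arr 3) (s.arr 1) (4 * k) b →
        Valid n k (family m k (vtx k s.arr)) (s.arr 3) (s'.arr 1) b := by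
  refine Ends.seq ((ends_copy hs).imp fun s1 _ _ h1 hb1 hf1 => ?_)
  have harr : ∀ a, a ≠ 2 → s1.arr a = s.arr a := fun a ha => hf1.2 a (by simpa using ha)
  have hreg : ∀ r, r ≠ 2 → s1.reg r = s.reg r := fun r hr => hf1.1 r (by simpa using hr)
  have hs1 : Setting B n m k s1 := hs.congr hb1 (hreg 0 (by omega)) (hreg 1 (by omega))
    (harr 0 (by omega)) (harr 3 (by omega))
  have hfam : family m k (vtx k s1.arr) = family m k (vtx k s.arr) := by
    have : vtx k s1.arr = vtx k s.arr := by ext; simp [vtx, harr 0]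
    rw [this]
  refine (ends_searchProg (4 * k) hs1 (fun v hv => by rw [h1 v hv]; exact hout v hv)
    (by rw [harr 1 (by omega)]; exact hout)).imp fun s2 _ _ ⟨_, h3, h4⟩ => ⟨h3, fun b hb h => ?_⟩
  rw [hfam, harr 3 (by omega)] at h4
  refine h4 b hb (Or.inr ?_)
  obtain ⟨χ', hχ', hval, hd⟩ := h
  refine ⟨χ', hχ', hval, ?_⟩
  have : diff n (s.arr 3) (s1.arr 2) χ' b = diff n (s.arr 3) (s.arr 1) χ' b := by
    ext v
    simp only [mem_diff]
    refine and_congr_right fun hv => ?_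
    rw [h1 v hv]
  rwa [this]

/-- Join the blocks in pairs, and process the resulting blocks. -/
def levelProg (k : ℕ) : Program :=
  .seq (.mapLt 0 3 (.get 4 (.get 3 (.reg 2)))) (.seq (.set 3 (.get 4 (.reg 3))) (processProg k))

/-- A colouring of all vertices, with the colours `1` and `0`, that is valid on the whole. -/
def IsSolution (n k : ℕ) (H : Set (Finset ℕ)) (χ : ℕ → ℕ) : Prop :=
  (∀ v < n, χ v ≤ 1) ∧ Valid n k H (fun _ => 0) χ 0

/-- A set inside a block is also a set inside the whole, so solutions restrict to every block. -/
theorem IsSolution.valid {H : Set (Finset ℕ)} {χ : ℕ → ℕ} (h : IsSolution n k H χ) (blk : ℕ → ℕ)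
    (b : ℕ) : Valid n k H blk χ b :=
  fun e he hb => h.2 e he fun v hv => ⟨(hb v hv).1, rfl⟩

/-- The situation after `t` levels: the blocks consist of `2 ^ t` consecutive vertices, and on each
of them the output is close to every solution. -/
structure AtLevel (B n m k : ℕ) (a0 : ℕ → ℕ) (t : ℕ) (s : Memory) : Prop where
  setting : Setting B n m k s
  arr0 : s.arr 0 = a0
  out : ∀ v < n, s.arr 1 v ≤ 1
  blk : ∀ v < n, s.arr 3 v = v / 2 ^ t
  half : ∀ x < n + 2, s.arr 4 x = x / 2
  reg3 : s.reg 3 = n / 2 ^ t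
  near : ∀ χ, IsSolution n k (family m k (vtx k s.arr)) χ →
    ∀ b, (diff n (s.arr 3) (s.arr 1) χ b).card ≤ 2 * k

theorem AtLevel.ends_levelProg {a0 : ℕ → ℕ} {t : ℕ} (h : AtLevel B n m k a0 t s) :
    Ends B B (levelProg k) s (AtLevel B n m k a0 (t + 1)) := by
  have hs := h.setting
  have hB := hs.two_le
  have hdiv : ∀ v, v / 2 ^ t / 2 = v / 2 ^ (t + 1) := fun v => by
    rw [Nat.div_div_eq_div_mul, pow_succ]
  have hle : ∀ v, v / 2 ^ t ≤ v := fun v => Nat.div_le_self _ _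
  have hle' : ∀ v, v / 2 ^ (t + 1) ≤ v := fun v => Nat.div_le_self _ _
  have hn := hs.n_lt
  refine Ends.seq ((Ends.mapLt (fun v => v / 2 ^ (t + 1)) hB le_rfl (by omega) hs.bdd
    fun v hv s' hr ha h3 => ?_).imp fun s1 _ _ h1 hb1 hf1 => ?_)
  · rw [hs.reg0] at hv
    have := hle v
    have := hle' v
    constructor
    · simp only [Expr.val, hr, Function.update_self, h3, ha 4 (by omega)]
      rw [h.blk v hv, h.half _ (by omega), hdiv]
    · omega
  rw [hs.reg0] at h1
  have harr1 : ∀ a, a ≠ 3 → s1.arr a = s.arr a := fun a ha => hf1.2 a (by simpa using ha)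
  have hreg1 : ∀ r, r ≠ 2 → s1.reg r = s.reg r := fun r hr => hf1.1 r (by simpa using hr)
  have hval : (Expr.get 4 (.reg 3)).val s1 = n / 2 ^ (t + 1) := by
    have := hle n
    simp only [Expr.val, hreg1 3 (by omega), harr1 4 (by omega)]
    rw [h.reg3, h.half _ (by omega), hdiv]
  refine Ends.seq (Ends.set hB (by omega) hb1 ?_ fun hb2 hf2 => ?_)
  · rw [hval]
    have := hle' n
    omega
  rw [hval] at hb2 hf2 ⊢
  set s2 := s1.setReg 3 (n / 2 ^ (t + 1)) with hs2def
  have harr2 : ∀ a, a ≠ 3 → s2.arr a = s.arr a := harr1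
  have hreg2 : ∀ r, r ≠ 2 → r ≠ 3 → s2.reg r = s.reg r := fun r hr hr3 => by
    rw [hs2def, Memory.setReg_reg, Function.update_of_ne hr3, hreg1 r hr]
  have hblk2 : ∀ v < n, s2.arr 3 v = v / 2 ^ (t + 1) := h1.1
  have hvtx : vtx k s2.arr = vtx k s.arr := by ext; simp [vtx, harr2 0]
  have hset2 : Setting B n m k s2 :=
    { two_le := hB
      bdd := hb2
      n_lt := hn
      reg0 := (hreg2 0 (by omega) (by omega)).trans hs.reg0
      reg1 := (hreg2 1 (by omega) (by omega)).trans hs.reg1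
      pos := hs.pos
      list := by rw [hvtx]; exact hs.list
      blk_lt := fun v hv => by
        rw [hblk2 v hv]
        exact (hle' v).trans_lt hv }
  refine (ends_processProg hset2 (by rw [harr2 1 (by omega)]; exact h.out)).imp
    fun s3 hb3 hf3 ⟨h3, h4⟩ => ?_
  have harr3 : ∀ {a}, a < 5 → a ≠ 1 → a ≠ 2 → s3.arr a = s2.arr a :=
    arr_eq_of_frame_processProg hf3
  have hreg3 : ∀ r, r ≠ 2 → s3.reg r = s2.reg r := fun r hr =>
    hf3.1 r fun h => hr (writesReg_processProg k r h)
  have a0' := harr3 (a := 0) (by omega) (by omega) (by omega)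
  have a3' := harr3 (a := 3) (by omega) (by omega) (by omega)
  have hvtx3 : vtx k s3.arr = vtx k s.arr := by rw [← hvtx]; ext; simp [vtx, a0']
  refine
    { setting := hset2.congr hb3 (hreg3 0 (by omega)) (hreg3 1 (by omega)) a0' a3'
      arr0 := a0'.trans ((harr2 0 (by omega)).trans h.arr0)
      out := h3
      blk := by rw [a3']; exact hblk2
      half := by
        rw [harr3 (a := 4) (by omega) (by omega) (by omega), harr2 4 (by omega)]
        exact h.half
      reg3 := by rw [hreg3 3 (by omega), hs2def]; simp
      near := ?_ }
  rw [hvtx3, a3']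
  rw [hvtx, harr2 1 (by omega)] at h4
  intro χ hχ b
  rcases lt_or_ge b n with hb | hb
  -- The two halves contribute at most `2 * k` each, which is where the search depth `4 * k` comes
  -- from. Once the output is valid on the joined block, the bound `2 * k` is restored, so the error
  -- does not accumulate over the levels.
  · refine card_diff_le_of_valid h3 hχ.1 (h4 b hb ⟨χ, hχ.1, hχ.valid _ _, ?_⟩) (hχ.valid _ _)
    have hsub : diff n (s2.arr 3) (s.arr 1) χ b ⊆
        diff n (s.arr 3) (s.arr 1) χ (2 * b) ∪ diff n (s.arr 3) (s.arr 1) χ (2 * b + 1) := by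
      intro v hv
      rw [mem_diff] at hv
      rw [mem_union, mem_diff, mem_diff, h.blk v hv.1]
      have h5 := hv.2.1
      rw [hblk2 v hv.1, ← hdiv] at h5
      rcases (show v / 2 ^ t = 2 * b ∨ v / 2 ^ t = 2 * b + 1 by omega) with h6 | h6
      · exact Or.inl ⟨hv.1, h6, hv.2.2⟩
      · exact Or.inr ⟨hv.1, h6, hv.2.2⟩
    have h5 := (card_le_card hsub).trans (card_union_le _ _)
    have h6 := h.near χ hχ (2 * b)
    have h7 := h.near χ hχ (2 * b + 1)
    omega
  · have : diff n (s2.arr 3) (s3.arr 1) χ b = ∅ := by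
      refine eq_empty_of_forall_notMem fun v hv => ?_
      have h5 := mem_diff.1 hv
      have := hset2.blk_lt v h5.1
      omega
    rw [this]
    simp

/-- The table of the halves of the numbers less than `n + 2`. -/
def halfProg : Program :=
  .forLt 0 (.put 4 (.add (.reg 2) (.const 2)) (.add (.get 4 (.reg 2)) (.const 1)))

/-- The machine has no division; the table is filled by `(i + 2) / 2 = i / 2 + 1`, starting from the
zeros at the positions `0` and `1`. -/
theorem ends_halfProg (hs : Setting B n m k s) (h4 : ∀ x < 2, s.arr 4 x = 0) :
    Ends B B halfProg s fun s' => ∀ x < n + 2, s'.arr 4 x = x / 2 := by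
  rw [← hs.reg0]
  refine Ends.forLt (I := fun l arr => ∀ x < l + 2, arr 4 x = x / 2) hs.two_le le_rfl (by omega)
    (by simp) hs.bdd (fun x hx => by rw [h4 x (by omega)]; omega) ?_
  intro i hi s' hs' hr _ hI
  have hval : (Expr.add (.get 4 (.reg 2)) (.const 1)).val s' = i / 2 + 1 := by
    simp [Expr.val, hr, hI i (by omega)]
  rw [hs.reg0] at hi
  have hn := hs.n_lt
  refine Ends.put hs.two_le le_rfl hs' (by rw [hval]; omega) fun x hx => ?_
  rw [hval]
  simp only [Expr.val, hr, Function.update_self, Memory.setArr_arr]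
  by_cases hx' : x = i + 2
  · rw [hx', Function.update_self]
    omega
  · rw [Function.update_of_ne hx', hI x (by omega)]

/-- The whole program, for `k ≥ 1`. -/
def mainProg (k : ℕ) : Program :=
  .seq (.mapLt 0 3 (.reg 2)) (.seq halfProg (.seq (.set 3 (.reg 0))
    (.seq (.loop (.reg 3) (levelProg k)) (.seq (processProg k)
      (.seq (.mapLt 0 2 (.get 1 (.reg 2))) (.seq (findProg k 0)
        (.cond (.reg 0) (.set 0 (.sub (.const 1) (.get (bad 0) (.const 0))))
          (.set 0 (.const 1)))))))))

/-- The initial part of the program: the blocks are the single vertices. -/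
theorem ends_init {W : ℕ} {Q : Memory → Prop} {P : Program} (hBW : B ≤ W)
    (hs : Setting B n m k s)
    (h0 : ∀ a, a ≠ 0 → ∀ x, s.arr a x = 0)
    (hP : ∀ s', AtLevel B n m k (s.arr 0) 0 s' → Ends B W P s' Q) :
    Ends B W (.seq (.mapLt 0 3 (.reg 2)) (.seq halfProg (.seq (.set 3 (.reg 0)) P))) s Q := by
  have hB := hs.two_le
  have hn := hs.n_lt
  refine Ends.seq ((Ends.mapLt (fun v => v) hB hBW (by omega) hs.bdd
    fun v hv s' hr _ _ => ?_).imp fun s1 _ _ h1 hb1 hf1 => ?_)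
  · rw [hs.reg0] at hv
    exact ⟨by rw [Expr.val, hr, Function.update_self], by omega⟩
  rw [hs.reg0] at h1
  have harr1 : ∀ a, a ≠ 3 → s1.arr a = s.arr a := fun a ha => hf1.2 a (by simpa using ha)
  have hreg1 : ∀ r, r ≠ 2 → s1.reg r = s.reg r := fun r hr => hf1.1 r (by simpa using hr)
  have hvtx1 : vtx k s1.arr = vtx k s.arr := by ext; simp [vtx, harr1 0]
  have hs1 : Setting B n m k s1 :=
    { two_le := hB
      bdd := hb1
      n_lt := hn
      reg0 := (hreg1 0 (by omega)).trans hs.reg0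
      reg1 := (hreg1 1 (by omega)).trans hs.reg1
      pos := hs.pos
      list := by rw [hvtx1]; exact hs.list
      blk_lt := fun v hv => by rwa [h1.1 v hv] }
  refine Ends.seq ((ends_halfProg hs1 fun x _ => ?_).mono hBW fun s2 _ _ h2 hb2 hf2 => ?_)
  · rw [harr1 4 (by omega), h0 4 (by omega)]
  have harr2 : ∀ a, a ≠ 4 → s2.arr a = s1.arr a := fun a ha =>
    hf2.2 a (by simpa [halfProg] using ha)
  have hreg2 : ∀ r, r ≠ 2 → s2.reg r = s1.reg r := fun r hr =>
    hf2.1 r (by simpa [halfProg] using hr)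
  have hs2 : Setting B n m k s2 := hs1.congr hb2 (hreg2 0 (by omega)) (hreg2 1 (by omega))
    (harr2 0 (by omega)) (harr2 3 (by omega))
  have hval : (Expr.reg 0).val s2 = n := by rw [Expr.val, hs2.reg0]
  refine Ends.seq (Ends.set hB (by omega) hb2 (by rw [hval]; omega) fun hb3 hf3 => hP _ ?_)
  rw [hval] at hb3 ⊢
  have hs3 : Setting B n m k (s2.setReg 3 n) := hs2.congr hb3
    (by simp) (by simp) rfl rfl
  have hout : ∀ v, s2.arr 1 v = 0 := fun v => by
    rw [harr2 1 (by omega), harr1 1 (by omega), h0 1 (by omega)]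
  refine
    { setting := hs3
      arr0 := (harr2 0 (by omega)).trans (harr1 0 (by omega))
      out := fun v hv => by rw [Memory.setReg_arr, hout]; omega
      blk := fun v hv => by
        rw [Memory.setReg_arr, harr2 3 (by omega), h1.1 v hv, pow_zero, Nat.div_one]
      half := h2
      reg3 := by simp
      near := fun χ hχ b => ?_ }
  -- A block is a single vertex, so the distance is at most `1`, which is below `2 * k`.
  have hsub : diff n ((s2.setReg 3 n).arr 3) ((s2.setReg 3 n).arr 1) χ b ⊆ {b} := by
    intro v hv
    rw [mem_diff, Memory.setReg_arr, harr2 3 (by omega)] at hv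
    rw [mem_singleton, ← hv.2.1, h1.1 v hv.1]
  have h5 := card_le_card hsub
  have h6 := hs.pos
  rw [card_singleton] at h5
  omega

/-- The final part of the program: there is only one block. -/
theorem AtLevel.ends_final {a0 : ℕ → ℕ} {t : ℕ} (h : AtLevel B n m k a0 t s)
    (h3 : s.reg 3 = 0) :
    Ends B B (.seq (processProg k) (.seq (.mapLt 0 2 (.get 1 (.reg 2))) (.seq (findProg k 0)
        (.cond (.reg 0) (.set 0 (.sub (.const 1) (.get (bad 0) (.const 0))))
          (.set 0 (.const 1)))))) s fun s' =>
      ((∃ χ, IsSolution n k (family m k (vtx k s.arr)) χ) →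
        s'.reg 0 = 1 ∧ IsSolution n k (family m k (vtx k s.arr)) (s'.arr 1)) ∧
      ((¬ ∃ χ, IsSolution n k (family m k (vtx k s.arr)) χ) → s'.reg 0 = 0) := by
  have hs := h.setting
  have hB := hs.two_le
  set H := family m k (vtx k s.arr) with hH
  -- Register `3` holds `n / 2 ^ t`; when it is zero, all vertices are in block `0`.
  have hblk : ∀ v < n, s.arr 3 v = 0 := fun v hv => by
    rw [h.blk v hv]
    have h5 := h.reg3.symm.trans h3
    exact Nat.le_zero.1 (h5 ▸ Nat.div_le_div_right hv.le)
  have hglobal : ∀ χ, Valid n k H (s.arr 3) χ 0 → Valid n k H (fun _ => 0) χ 0 :=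
    fun χ hχ e he hb => hχ e he fun v hv => ⟨(hb v hv).1, hblk v (hb v hv).1⟩
  refine Ends.seq ((ends_processProg hs h.out).imp fun s1 _ _ ⟨h1, h2⟩ hb1 hf1 => ?_)
  have harr1 : ∀ {a}, a < 5 → a ≠ 1 → a ≠ 2 → s1.arr a = s.arr a :=
    arr_eq_of_frame_processProg hf1
  have hreg1 : ∀ r, r ≠ 2 → s1.reg r = s.reg r := fun r hr =>
    hf1.1 r fun h => hr (writesReg_processProg k r h)
  have hs1 : Setting B n m k s1 := hs.congr hb1 (hreg1 0 (by omega)) (hreg1 1 (by omega))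
    (harr1 (by omega) (by omega) (by omega)) (harr1 (by omega) (by omega) (by omega))
  refine Ends.seq ((ends_copy hs1).imp fun s2 _ _ h4 hb2 hf2 => ?_)
  have harr2 : ∀ a, a ≠ 2 → s2.arr a = s1.arr a := fun a ha => hf2.2 a (by simpa using ha)
  have hreg2 : ∀ r, r ≠ 2 → s2.reg r = s1.reg r := fun r hr => hf2.1 r (by simpa using hr)
  have hs2 : Setting B n m k s2 := hs1.congr hb2 (hreg2 0 (by omega)) (hreg2 1 (by omega))
    (harr2 0 (by omega)) (harr2 3 (by omega))
  have hfam : family m k (vtx k s2.arr) = H := by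
    have : vtx k s2.arr = vtx k s.arr := by
      ext
      simp only [vtx, harr2 0 (by omega), harr1 (a := 0) (by omega) (by omega) (by omega)]
    rw [this]
  refine Ends.seq ((ends_findProg hs2 0).imp fun s3 _ _ h5 hb3 hf3 => ?_)
  rw [hfam, harr2 3 (by omega), harr1 (a := 3) (by omega) (by omega) (by omega)] at h5
  have hreg3 : s3.reg 0 = n := by
    rw [hf3.1 0 fun h => by have := writesReg_findProg k 0 0 h; omega, hs2.reg0]
  have hout3 : s3.arr 1 = s1.arr 1 := by
    rw [hf3.2 1, harr2 1 (by omega)]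
    intro h
    rcases writesArr_findProg k 0 1 h with h | h | h | ⟨i, -, h⟩
    · omega
    · omega
    · exact bad_ne (by omega) h.symm
    · exact viol_ne (by omega) h.symm
  have hsol : (∃ χ, IsSolution n k H χ) → ∀ b < n, Valid n k H (s.arr 3) (s1.arr 1) b := by
    rintro ⟨χ, hχ⟩ b hb
    refine h2 b hb ⟨χ, hχ.1, hχ.valid _ _, (h.near χ hχ b).trans (by omega)⟩
  -- Without vertices there is no block `0` whose mark could be consulted; then every colouring is a
  -- solution, as `k > 0`.
  refine Ends.cond hB (by omega) hb3 (fun hn => ?_) fun hn => ?_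
  · rw [Expr.val, hreg3] at hn
    have hn' : 0 < n := by omega
    refine Ends.set hB (by omega) hb3 ?_ ?_
    · simp only [Expr.val]
      omega
    simp only [Expr.val, Memory.setReg_reg, Function.update_self, Memory.setReg_arr, hout3]
    rcases h5 0 hn' with ⟨h6, h7⟩ | ⟨h6, h7⟩
    · have h8 : IsSolution n k H (s1.arr 1) :=
        ⟨h1, hglobal _ (h7.congr fun v hv _ => h4 v hv)⟩
      exact ⟨fun _ => ⟨by rw [h6], h8⟩, fun h => absurd ⟨_, h8⟩ h⟩
    · have h8 : ¬ ∃ χ, IsSolution n k H χ := fun h =>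
        ((hsol h 0 hn').congr fun v hv _ => (h4 v hv).symm).not_violates h7
      exact ⟨fun h => absurd h h8, fun _ => by rw [h6]⟩
  · rw [Expr.val, hreg3] at hn
    refine Ends.set hB (by omega) hb3 (by simp only [Expr.val]; omega) ?_
    have h8 : ∀ χ, IsSolution n k H χ := by
      subst hn
      refine fun χ => ⟨by simp, fun e he hb => ?_⟩
      have hpos := hs.pos
      rw [← he, card_pos] at hpos
      obtain ⟨v, hv⟩ := hpos
      exact absurd (hb v hv).1 (by omega)
    exact ⟨fun _ => ⟨by simp [Expr.val], h8 _⟩, fun h => absurd ⟨0, h8 0⟩ h⟩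

theorem ends_mainProg (hs : Setting B n m k s) (h0 : ∀ a, a ≠ 0 → ∀ x, s.arr a x = 0) :
    Ends B (B * (n.size + 1)) (mainProg k) s fun s' =>
      ((∃ χ, IsSolution n k (family m k (vtx k s.arr)) χ) →
        s'.reg 0 = 1 ∧ IsSolution n k (family m k (vtx k s.arr)) (s'.arr 1)) ∧
      ((¬ ∃ χ, IsSolution n k (family m k (vtx k s.arr)) χ) → s'.reg 0 = 0) := by
  have hB := hs.two_le
  have hBW : B ≤ B * (n.size + 1) := Nat.le_mul_of_pos_right _ (by omega)
  refine ends_init hBW hs h0 fun s1 h1 => ?_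
  -- The measure `l` satisfies `n / 2 ^ t < 2 ^ l`. It can start at `n.size` because `n < 2 ^
  -- n.size`, and every level lowers it by one.
  refine Ends.seq ((Ends.loop (W := B) (I := fun l s' => ∃ t, AtLevel B n m k (s.arr 0) t s' ∧
    n / 2 ^ t < 2 ^ l) hB (by omega) n.size h1.setting.bdd ⟨0, h1, ?_⟩ ?_).imp
    fun s2 _ _ ⟨h2, l, t, h3, _⟩ hb2 hf2 => ?_)
  · simpa using n.lt_size_self
  · rintro l s' hb ⟨t, ht, hl⟩ hne
    rw [Expr.val, ht.reg3] at hne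
    rcases l with _ | l
    · exact absurd (Nat.lt_one_iff.1 (by simpa using hl)) hne
    · refine ⟨l, rfl, ht.ends_levelProg.imp fun s'' _ _ h => ⟨t + 1, h, ?_⟩⟩
      rw [pow_succ, ← Nat.div_div_eq_div_mul]
      rw [pow_succ] at hl
      omega
  · have hvtx : vtx k s2.arr = vtx k s.arr := by ext; simp [vtx, h3.arr0]
    rw [← hvtx]
    exact (h3.ends_final h2).mono hBW fun _ _ _ h => h

end SplitSearch

/-! ## Listings of hypergraphs -/

namespace Hypergraph.Listing

open RandomAccess BlockColouring SplitSearch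

variable {α : Type*} {G : Hypergraph α} {k : ℕ} (L : G.Listing k)

theorem vtx_input {j i : ℕ} (hj : j < L.m) (hi : i < k) :
    vtx k L.input.arr j i = L.edge ⟨j, hj⟩ ⟨i, hi⟩ := by
  have hlt : k * j + i < L.m * k := by nlinarith
  have h1 : Fin.divNat (⟨k * j + i, hlt⟩ : Fin (L.m * k)) = ⟨j, hj⟩ := by
    ext
    simp only [Fin.divNat]
    rw [Nat.mul_add_div (by omega), Nat.div_eq_of_lt hi, add_zero]
  have h2 : Fin.modNat (⟨k * j + i, hlt⟩ : Fin (L.m * k)) = ⟨i, hi⟩ := by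
    ext
    simp only [Fin.modNat]
    rw [Nat.mul_add_mod, Nat.mod_eq_of_lt hi]
  simp only [vtx, input]
  rw [dif_pos ⟨trivial, hlt⟩, h1, h2]

/-- The set of the vertices with numbers in `e`. -/
def vertices (e : Finset ℕ) : Set α := {x | ∃ i : Fin L.n, (i : ℕ) ∈ e ∧ L.vertex i = x}

theorem vertex_mem_vertices {e : Finset ℕ} {i : Fin L.n} :
    L.vertex i ∈ L.vertices e ↔ (i : ℕ) ∈ e := by
  constructor
  · rintro ⟨i', hi', h⟩
    rwa [← L.vertex_injective h]
  · exact fun h => ⟨i, h, rfl⟩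

theorem vertices_inj {e e' : Finset ℕ} (he : ∀ v ∈ e, v < L.n) (he' : ∀ v ∈ e', v < L.n)
    (h : L.vertices e = L.vertices e') : e = e' := by
  have key : ∀ v (hv : v < L.n), v ∈ e ↔ v ∈ e' := fun v hv => by
    have h1 := L.vertex_mem_vertices (e := e) (i := ⟨v, hv⟩)
    have h2 := L.vertex_mem_vertices (e := e') (i := ⟨v, hv⟩)
    rw [h] at h1
    exact h1.symm.trans h2
  ext v
  exact ⟨fun h => (key v (he v h)).1 h, fun h => (key v (he' v h)).2 h⟩

theorem encard_vertices {e : Finset ℕ} (he : ∀ v ∈ e, v < L.n) :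
    (L.vertices e).encard = e.card := by
  have h1 : L.vertices e = L.vertex '' {i | (i : ℕ) ∈ e} := by
    ext x
    simp [vertices]
  have h2 : (e : Set ℕ) = Fin.val '' {i : Fin L.n | (i : ℕ) ∈ e} := by
    ext v
    simp only [Finset.mem_coe, Set.mem_image, Set.mem_ofPred_eq]
    exact ⟨fun h => ⟨⟨v, he v h⟩, h, rfl⟩, by rintro ⟨i, hi, rfl⟩; exact hi⟩
  rw [h1, L.vertex_injective.encard_image, ← Set.encard_coe_eq_coe_finsetCard, h2,
    Fin.val_injective.encard_image]

theorem exists_vertices_eq {A : Set α} (hA : A ⊆ G.vertexSet) :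
    ∃ e : Finset ℕ, (∀ v ∈ e, v < L.n) ∧ L.vertices e = A := by
  classical
  refine ⟨((Finset.univ : Finset (Fin L.n)).filter fun i => L.vertex i ∈ A).image Fin.val,
    ?_, ?_⟩
  · simp only [Finset.mem_image]
    rintro v ⟨i, -, rfl⟩
    exact i.2
  · ext x
    constructor
    · rintro ⟨i, hi, rfl⟩
      obtain ⟨i', hi', h⟩ := Finset.mem_image.1 hi
      rw [← Fin.ext h]
      exact (Finset.mem_filter.1 hi').2
    · intro hx
      obtain ⟨i, rfl⟩ := L.range_vertex.ge (hA hx)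
      exact ⟨i, Finset.mem_image.2 ⟨i, by simpa using hx, rfl⟩, rfl⟩

theorem edgeAt_lt {j v : ℕ} (hj : j < L.m) (hv : v ∈ edgeAt k (vtx k L.input.arr) j) :
    v < L.n := by
  obtain ⟨i, hi, rfl⟩ := mem_edgeAt.1 hv
  rw [L.vtx_input hj hi]
  exact Fin.is_lt _

theorem vertices_edgeAt {j : ℕ} (hj : j < L.m) :
    L.vertices (edgeAt k (vtx k L.input.arr) j) = Set.range (L.vertex ∘ L.edge ⟨j, hj⟩) := by
  ext x
  constructor
  · rintro ⟨i, hi, rfl⟩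
    obtain ⟨l, hl, h⟩ := mem_edgeAt.1 hi
    rw [L.vtx_input hj hl] at h
    exact ⟨⟨l, hl⟩, congrArg L.vertex (Fin.ext h)⟩
  · rintro ⟨l, rfl⟩
    exact ⟨L.edge ⟨j, hj⟩ l, mem_edgeAt.2 ⟨l, l.2, L.vtx_input hj l.2⟩, rfl⟩

theorem isListing_input : IsListing L.n L.m k (vtx k L.input.arr) where
  lt j hj i hi := by
    rw [L.vtx_input hj hi]
    exact Fin.is_lt _
  injOn j hj i hi i' hi' h := by
    rw [L.vtx_input hj hi, L.vtx_input hj hi'] at h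
    exact congrArg Fin.val (L.edge_injective _ (Fin.ext h))
  edgeAt_inj j hj j' hj' h := by
    have h1 := L.vertices_edgeAt hj
    rw [h, L.vertices_edgeAt hj'] at h1
    exact (congrArg Fin.val (L.edgeSet_injective h1)).symm

theorem vertices_mem_edgeSet {e : Finset ℕ} (he : ∀ v ∈ e, v < L.n) :
    L.vertices e ∈ G.edgeSet ↔ e ∈ family L.m k (vtx k L.input.arr) := by
  rw [← L.range_edgeSet]
  constructor
  · rintro ⟨j, hj⟩
    refine ⟨j, j.2, L.vertices_inj (fun v => L.edgeAt_lt j.2) he ?_⟩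
    rw [L.vertices_edgeAt j.2]
    exact hj
  · rintro ⟨j, hj, rfl⟩
    exact ⟨⟨j, hj⟩, (L.vertices_edgeAt hj).symm⟩

theorem exists_isSolution (h : G.IsSplit k) :
    ∃ χ, IsSolution L.n k (family L.m k (vtx k L.input.arr)) χ := by
  classical
  obtain ⟨A, B, hAB⟩ := h
  refine ⟨fun v => if ∃ h : v < L.n, L.vertex ⟨v, h⟩ ∈ A then 1 else 0, fun v _ => ?_,
    fun e he hb => ?_⟩
  · dsimp only
    split_ifs <;> omega
  · have hlt : ∀ v ∈ e, v < L.n := fun v hv => (hb v hv).1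
    rw [← L.vertices_mem_edgeSet hlt]
    have hcard : (L.vertices e).encard = k := by rw [L.encard_vertices hlt, he]
    constructor
    · refine fun h => hAB.mem_edgeSet _ ?_ hcard
      rintro x ⟨i, hi, rfl⟩
      by_contra hx
      have := h i hi
      dsimp only at this
      rw [if_neg (by rintro ⟨_, h⟩; exact hx h)] at this
      omega
    · refine fun h => hAB.notMem_edgeSet _ ?_ hcard
      rintro x ⟨i, hi, rfl⟩
      have hx : L.vertex i ∈ A ∪ B := by
        rw [hAB.union_eq, ← L.range_vertex]
        exact ⟨i, rfl⟩
      refine hx.resolve_left fun hx => ?_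
      have := h i hi
      dsimp only at this
      rw [if_pos ⟨i.2, hx⟩] at this
      omega

theorem isSplitting_of_isSolution {s : Memory}
    (h : IsSolution L.n k (family L.m k (vtx k L.input.arr)) (s.arr 1)) :
    G.IsSplitting k (L.outputClass s 1) (L.outputClass s 0) := by
  have hsub : ∀ b, L.outputClass s b ⊆ G.vertexSet := by
    rintro b x ⟨i, rfl, -⟩
    rw [← L.range_vertex]
    exact ⟨i, rfl⟩
  have hcol : ∀ {b : ℕ} {e : Finset ℕ}, L.vertices e ⊆ L.outputClass s b → (∀ v ∈ e, v < L.n) →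
      ∀ v ∈ e, s.arr 1 v = b := by
    intro b e he hlt v hv
    obtain ⟨i, hi, hb⟩ := he ((L.vertex_mem_vertices (i := ⟨v, hlt v hv⟩)).2 hv)
    rwa [L.vertex_injective hi] at hb
  refine ⟨?_, ?_, ?_, ?_⟩
  · refine Set.Subset.antisymm (Set.union_subset (hsub 1) (hsub 0)) fun x hx => ?_
    obtain ⟨i, rfl⟩ := L.range_vertex.ge hx
    have := h.1 i i.2
    rcases (show s.arr 1 i = 1 ∨ s.arr 1 i = 0 by omega) with h1 | h1
    · exact Or.inl ⟨i, rfl, h1⟩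
    · exact Or.inr ⟨i, rfl, h1⟩
  · rw [Set.disjoint_left]
    rintro x ⟨i, rfl, h1⟩ ⟨i', h2, h3⟩
    rw [L.vertex_injective h2] at h3
    omega
  · intro e' he' hk
    obtain ⟨e, hlt, rfl⟩ := L.exists_vertices_eq (he'.trans (hsub 1))
    rw [L.encard_vertices hlt] at hk
    exact (L.vertices_mem_edgeSet hlt).2 ((h.2 e (by exact_mod_cast hk)
      fun v hv => ⟨hlt v hv, rfl⟩).1 (hcol he' hlt))
  · intro e' he' hk
    obtain ⟨e, hlt, rfl⟩ := L.exists_vertices_eq (he'.trans (hsub 0))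
    rw [L.encard_vertices hlt] at hk
    rw [L.vertices_mem_edgeSet hlt]
    exact (h.2 e (by exact_mod_cast hk) fun v hv => ⟨hlt v hv, rfl⟩).2 (hcol he' hlt)

theorem size_eq : G.size = L.n + L.m := by
  rw [size, ← L.range_vertex, ← L.range_edgeSet, ← Set.image_univ, ← Set.image_univ,
    Set.ncard_image_of_injective _ L.vertex_injective,
    Set.ncard_image_of_injective _ L.edgeSet_injective, Set.ncard_univ, Set.ncard_univ,
    Nat.card_fin, Nat.card_fin]

theorem setting_input (hk : 0 < k) : Setting (L.n + L.m + 2) L.n L.m k L.input where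
  two_le := by omega
  bdd := by
    refine ⟨fun r => ?_, fun a x => ?_⟩
    · simp only [input]
      split_ifs <;> omega
    · simp only [input]
      split_ifs with h
      · have := (L.edge (Fin.divNat ⟨x, h.2⟩) (Fin.modNat ⟨x, h.2⟩)).2
        omega
      · omega
  n_lt := le_rfl
  reg0 := rfl
  reg1 := rfl
  pos := hk
  list := L.isListing_input
  blk_lt v hv := by
    simp only [input]
    rw [dif_neg (by simp)]
    omega

end Hypergraph.Listing

/-- For `k = 0`, no hypergraph is split: the empty set would have to be an edge and a non-edge. -/
theorem Hypergraph.not_isSplit_zero {α : Type*} (G : Hypergraph α) : ¬ G.IsSplit 0 := by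
  rintro ⟨A, B, h⟩
  exact h.notMem_edgeSet ∅ (Set.empty_subset _) (by simp)
    (h.mem_edgeSet ∅ (Set.empty_subset _) (by simp))

/-! ### The time bound in terms of `N`, and the conclusion. -/

theorem mul_size_le_mul_log {n N : ℕ} (hn : n ≤ N) (hN : 2 ≤ N) :
    (((N + 2) * (n.size + 1) : ℕ) : ℝ) ≤ 12 * (N * Real.log N) := by
  have h1 : n.size ≤ Nat.log 2 N + 1 :=
    Nat.size_le.2 (hn.trans_lt (Nat.lt_pow_succ_log_self (by omega) N))
  have h2 : (2 : ℝ) ^ Nat.log 2 N ≤ N := by exact_mod_cast Nat.pow_log_le_self 2 (by omega)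
  have h3 : Nat.log 2 N * Real.log 2 ≤ Real.log N := by
    rw [← Real.log_pow]
    exact Real.log_le_log (by positivity) h2
  have h4 : Real.log 2 ≤ Real.log N :=
    Real.log_le_log (by norm_num) (by exact_mod_cast hN)
  have h5 := Real.log_two_gt_d9
  have h6 : (n.size : ℝ) ≤ Nat.log 2 N + 1 := by exact_mod_cast h1
  have h7 : (2 : ℝ) ≤ N := by exact_mod_cast hN
  -- The left side is at most `Nat.log 2 N + 2`, hence at most `3 * log N / log 2` because `log N ≥
  -- log 2`; and `3 / log 2 < 6`. The factor `12` then comes from `N + 2 ≤ 2 * N`.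
  have h8 : ((n.size : ℝ) + 1) ≤ 6 * Real.log N := by
    have : (0 : ℝ) ≤ Nat.log 2 N := by positivity
    nlinarith
  push_cast
  calc ((N : ℝ) + 2) * (n.size + 1) ≤ (2 * N) * (6 * Real.log N) := by
        gcongr
        linarith
    _ = 12 * (N * Real.log N) := by ring

theorem theoremt (k : ℕ) :
    ∃ (P : RandomAccess.Program) (c : ℕ) (C : ℝ),
      ∀ (α : Type*) (G : Hypergraph α), G.vertexSet.Finite → G.IsUniform k →
        ∀ L : G.Listing k, ∃ (t : ℕ) (s : RandomAccess.Memory),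
          RandomAccess.Exec ((G.size + 2) ^ c) P L.input t s ∧
          (2 ≤ G.size → (t : ℝ) ≤ C * (G.size * Real.log G.size)) ∧
          (G.IsSplit k → s.reg 0 = 1 ∧
            G.IsSplitting k (L.outputClass s 1) (L.outputClass s 0)) ∧
          (¬ G.IsSplit k → s.reg 0 = 0) := by
  rcases Nat.eq_zero_or_pos k with rfl | hk
  -- For `k = 0` the answer is always no. One assignment takes time `2`, and `C = 2` suffices since
  -- `N * log N ≥ 2 * log 2 > 1`.
  · refine ⟨.set 0 (.const 0), 1, 2, fun α G _ _ L => ⟨_, _,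
      .set 0 (.const 0) _ (by simp [RandomAccess.Expr.Fits]), fun hN => ?_,
      fun h => absurd h G.not_isSplit_zero, fun _ => by simp [RandomAccess.Expr.val]⟩⟩
    have h1 : (2 : ℝ) ≤ G.size := by exact_mod_cast hN
    have h2 : Real.log 2 ≤ Real.log G.size := Real.log_le_log (by norm_num) h1
    have h3 := Real.log_two_gt_d9
    simp only [RandomAccess.Expr.cost]
    push_cast
    nlinarith
  · refine ⟨SplitSearch.mainProg k, (SplitSearch.mainProg k).deg,
      (SplitSearch.mainProg k).steps * 12, fun α G _ _ L => ?_⟩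
    obtain ⟨t, s, h1, h2, -, h3, h4⟩ := SplitSearch.ends_mainProg (L.setting_input hk)
      (fun a ha x => by simp [Hypergraph.Listing.input, ha]) _ le_rfl
    rw [← L.size_eq] at h1 h2
    refine ⟨t, s, h1, fun hN => ?_, fun h => ?_, fun h => h4 ?_⟩
    · have h5 := mul_size_le_mul_log (n := L.n) (by rw [L.size_eq]; omega) hN
      have h6 : (t : ℝ) ≤ (SplitSearch.mainProg k).steps *
          (((G.size + 2) * (L.n.size + 1) : ℕ) : ℝ) := by exact_mod_cast h2
      refine h6.trans ?_
      rw [mul_assoc]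
      gcongr
    · obtain ⟨h5, h6⟩ := h3 (L.exists_isSolution h)
      exact ⟨h5, L.isSplitting_of_isSolution h6⟩
    · rintro ⟨χ, hχ⟩
      -- An auxiliary memory whose arrays all equal `χ`, so that the translation of outputs into
      -- splittings applies to an arbitrary solution.
      let s' : RandomAccess.Memory := ⟨fun _ => 0, fun _ => χ⟩
      exact h ⟨_, _, L.isSplitting_of_isSolution (s := s') hχ⟩
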